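/- **Setting.** Let $X$ be a finite-dimensional real inner product space (state space), $U\subseteq\mathbb R^m$ a control set, $f$ a state function assigning $f(x,u)\in X$ to $x\in X$, $u\in U$, and $F(x)=\{f(x,u):u\in U\}$. Let $\psi:X\times X\to(0,\infty)$ be continuous, let $X_{obst}\subseteq X$ be closed, and put $X_{free}=X\setminus X_{obst}$. Assume: 1. every $F(x)$ is nonempty and convex, the graph of $F$ is closed, and $F$ is bounded over every compact set; 2. there are $\gamma,c>0$ with $\|v\|\le\gamma\|x\|+c$ for all $x\in X$, $v\in F(x)$; 3. for every compact $K\subseteq X$ there is $k>0$ with $F(x)\subseteq F(y)+k\|x-y\|\overline{B_1(0)}$ for all $x,y\in K$; 4. (the problem parametrized by cost is a well-posed minimal-time problem) for every $x$ the set $\{\theta v/\psi(x,v): v\in F(x),\ 0\le\theta\le1\}$ is convex, and there are $\gamma',c'>0$ with $\|v\|/\psi(x,v)\le\gamma'\|x\|+c'$ for all $x\in X$, $v\in F(x)$. (The convexity holds, for instance, whenever $\psi(x,\cdot)$ is convex on $F(x)$, in particular if $\psi$ does not depend on $v$.) An admissible trajectory from $x$ to $y$ is an absolutely continuous $\pi:[0,T_\pi]\to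 X$, $T_\pi\ge0$, with $\pi(0)=x$, $\pi(T_\pi)=y$, $\pi(t)\in\overline{X_{free}}$ for all $t$, and $\dot\pi(t)=f(\pi(t),u(t))$, $u(t)\in U$ for a.e. $t$, for some function $u$. Its cost is $c_\pi=\int_0^{T_\pi}\psi(\pi,\dot\pi)\,dt$. Let $d_c(x,y)\in[0,\infty]$ be the infimum of the costs of the admissible trajectories from $x$ to $y$ ($\infty$ if there are none); $\pi$ is optimal if $c_\pi=d_c(x,y)$. Put $\mathrm{clr}(x)=\inf_{y\in X_{obst}}d_c(x,y)$ and $\mathrm{wit}(x)=\{y\in\partial X_{obst}:d_c(x,y)=\mathrm{clr}(x)\}$. For $\rho>0$ let $W_\rho=\{x\in X_{free}:\mathrm{clr}(x)<\rho\}$. For $x\in X_{free}$ let $\rho_{min}(x)$ and $\rho_{max}(x)$ be the infimum and the supremum of $\{\rho>0:x\in\partial W_\rho\}$, both being $\infty$ by convention if $\mathrm{clr}(x)=\infty$. The wave envelope is $E=\{x\in X_{free}:\rho_{min}(x)<\rho_{max}(x)\}$. **Theorem.** Let $x\in E$, let $y\in\mathrm{wit}(x)$, and let $\pi$ be an optimal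 admissible trajectory from $x$ to $y$. Then $\pi(t)\in E$ for all $t\in[0,T_\pi)$. -/

import Mathlib

open MeasureTheory Set
open scoped ENNReal Pointwise

/-- The data of a control problem with obstacles: the control space `U`, the state function
`f`, the running cost `ψ`, and the obstacle set `obst`.  The state space is the whole of `X`. -/
structure ControlSystem (X : Type*) (m : ℕ) where
  U : Set (EuclideanSpace ℝ (Fin m))
  f : X → EuclideanSpace ℝ (Fin m) → X
  ψ : X → X → ℝ
  obst : Set X

namespace ControlSystem

variable {X : Type*} [NormedAddCommGroup X] [InnerProductSpace ℝ X] {m : ℕ}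

/-- The admissible velocity multifunction `F(x) = {f(x,u) : u ∈ U}`. -/
def F (S : ControlSystem X m) (x : X) : Set X := S.f x '' S.U

/-- The free space, the complement of the obstacle set. -/
def free (S : ControlSystem X m) : Set X := S.obstᶜ

/-- Velocities per unit of cost, slowed down by an arbitrary factor in `[0,1]`. -/
def costVel (S : ControlSystem X m) (x : X) : Set X :=
  {w | ∃ v ∈ S.F x, ∃ θ ∈ Icc (0 : ℝ) 1, w = (θ / S.ψ x v) • v}

/-- The standing hypotheses. -/
structure Standing (S : ControlSystem X m) : Prop where
  obst_closed : IsClosed S.obst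
  ψ_continuous : Continuous (fun p : X × X => S.ψ p.1 p.2)
  ψ_pos : ∀ x v, 0 < S.ψ x v
  /-- nonempty, convex velocity sets with closed graph, bounded over compact sets -/
  F_nonempty : ∀ x, (S.F x).Nonempty
  F_convex : ∀ x, Convex ℝ (S.F x)
  F_closed_graph : IsClosed {p : X × X | p.2 ∈ S.F p.1}
  F_bounded : ∀ K : Set X, IsCompact K → ∃ M > (0 : ℝ), ∀ x ∈ K, ∀ v ∈ S.F x, ‖v‖ ≤ M
  /-- linear growth -/
  F_growth : ∃ γ > (0 : ℝ), ∃ c > (0 : ℝ), ∀ x, ∀ v ∈ S.F x, ‖v‖ ≤ γ * ‖x‖ + c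
  /-- local Lipschitz regularity -/
  F_lipschitz : ∀ K : Set X, IsCompact K → ∃ k > (0 : ℝ), ∀ x ∈ K, ∀ y ∈ K,
    S.F x ⊆ S.F y + (k * ‖x - y‖) • Metric.closedBall (0 : X) 1
  /-- the problem reparametrized by cost is a minimal time problem with convex velocity sets
  (waiting allowed) and linear growth -/
  costVel_convex : ∀ x, Convex ℝ (S.costVel x)
  cost_growth : ∃ γ > (0 : ℝ), ∃ c > (0 : ℝ), ∀ x, ∀ v ∈ S.F x,
    ‖(S.ψ x v)⁻¹ • v‖ ≤ γ * ‖x‖ + c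

/-- `p` restricted to `[0,T]` is an unconstrained trajectory from `x` to `y`. -/
structure IsUnconstrainedTraj (S : ControlSystem X m) (x y : X) (T : ℝ) (p : ℝ → X) : Prop where
  nonneg : 0 ≤ T
  ac : AbsolutelyContinuousOnInterval p 0 T
  ode : ∃ u : ℝ → EuclideanSpace ℝ (Fin m), ∀ᵐ t ∂(volume.restrict (Icc 0 T)),
    u t ∈ S.U ∧ HasDerivAt p (S.f (p t) (u t)) t
  start : p 0 = x
  finish : p T = y

/-- `p` restricted to `[0,T]` is an admissible trajectory from `x` to `y`. -/
structure IsTraj (S : ControlSystem X m) (x y : X) (T : ℝ) (p : ℝ → X) : Prop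
    extends IsUnconstrainedTraj S x y T p where
  mem_closure : ∀ t ∈ Icc 0 T, p t ∈ closure S.free

/-- The cost of traversing `p` on `[0,T]`. -/
noncomputable def cost (S : ControlSystem X m) (T : ℝ) (p : ℝ → X) : ℝ≥0∞ :=
  ∫⁻ t in Icc 0 T, ENNReal.ofReal (S.ψ (p t) (deriv p t))

/-- The cost-distance from `x` to `y` (`∞` if there is no admissible trajectory). -/
noncomputable def dist (S : ControlSystem X m) (x y : X) : ℝ≥0∞ :=
  ⨅ (T : ℝ) (p : ℝ → X) (_ : S.IsTraj x y T p), S.cost T p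

/-- The clearance from the obstacle set. -/
noncomputable def clr (S : ControlSystem X m) (x : X) : ℝ≥0∞ :=
  ⨅ y ∈ S.obst, S.dist x y

/-- The set of witness points. -/
def wit (S : ControlSystem X m) (x : X) : Set X :=
  {y | y ∈ frontier S.obst ∧ S.dist x y = S.clr x}

/-- `p` restricted to `[0,T]` is an optimal trajectory from `x` to `y`. -/
def IsOptimalTraj (S : ControlSystem X m) (x y : X) (T : ℝ) (p : ℝ → X) : Prop :=
  S.IsTraj x y T p ∧ S.cost T p = S.dist x y

/-- The reverse reachable set of radius `ρ`. -/
def revReach (S : ControlSystem X m) (ρ : ℝ) (x : X) : Set X :=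
  {y | S.dist y x < ENNReal.ofReal ρ}

/-- The propagating wave. -/
def wave (S : ControlSystem X m) (ρ : ℝ) : Set X :=
  {x | x ∈ S.free ∧ S.clr x < ENNReal.ofReal ρ}

open Classical in
/-- First arrival of wave fronts. -/
noncomputable def rhoMin (S : ControlSystem X m) (x : X) : ℝ≥0∞ :=
  if S.clr x = ∞ then ∞
  else ⨅ (ρ : ℝ) (_ : 0 < ρ ∧ x ∈ frontier (S.wave ρ)), ENNReal.ofReal ρ

open Classical in
/-- Last arrival of wave fronts. -/
noncomputable def rhoMax (S : ControlSystem X m) (x : X) : ℝ≥0∞ :=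
  if S.clr x = ∞ then ∞
  else ⨆ (ρ : ℝ) (_ : 0 < ρ ∧ x ∈ frontier (S.wave ρ)), ENNReal.ofReal ρ

/-- The wave envelope. -/
def envelope (S : ControlSystem X m) : Set X :=
  {x | x ∈ S.free ∧ S.rhoMin x < S.rhoMax x}

/-- The wave is the free part of the union of the reverse reachable sets of the points of the
obstacle boundary. -/
theorem wave_eq (S : ControlSystem X m) (hS : IsClosed S.obst) (ρ : ℝ) :
    S.wave ρ = S.free ∩ ⋃ y ∈ frontier S.obst, S.revReach ρ y := by
  ext x
  simp only [wave, clr, revReach, mem_ofPred_eq, mem_inter_iff, mem_iUnion, iInf_lt_iff,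
    exists_prop]
  refine and_congr_right fun _ => ⟨?_, ?_⟩
  · rintro ⟨y, hy, h⟩
    refine ⟨y, ?_, h⟩
    obtain ⟨T, p, hp, -⟩ := by simpa only [dist, iInf_lt_iff] using h
    have h2 : y ∈ closure S.obstᶜ := by
      have := hp.mem_closure T ⟨hp.nonneg, le_rfl⟩
      rwa [hp.finish] at this
    rw [frontier_eq_closure_inter_closure]
    exact ⟨subset_closure hy, h2⟩
  · rintro ⟨y, hy, h⟩
    exact ⟨y, hS.frontier_subset hy, h⟩

end ControlSystem

/-! A point of the envelope has finite clearance and lies on the frontiers of two waves, of radii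
`ρ₁ < ρ₂`. Three facts carry the proof.

Lower semicontinuity of the clearance (`Standing.clr_le_of_mem_closure`): a point in the closure of
the wave of radius `ρ₁` has clearance at most `ρ₁`. Near-optimal trajectories from nearby points are
parametrized by cost. These curves are uniformly Lipschitz and have a limit; convexity and upper
semicontinuity of `costVel` make the limit a solution of the same inclusion. A change of time turns
it back into a trajectory of cost at most `ρ₁`.

Stability (`IsTraj.eventually_exists_near`): by Filippov's theorem a trajectory inside the open free
space can be followed from all nearby starting points at nearly the same cost. Hence, if it ends in
the interior of a wave, its start is interior to every wave whose radius exceeds that of the first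
by more than the cost (`IsTraj.mem_interior_wave`).

Optimality: before its end the trajectory is in the free space, since touching the obstacle earlier
would be cheaper; moreover the cost up to time `t` plus the clearance of `p t` is at most `ρ₁`.

Now let `ρ` lie strictly between the clearance of `p t` and that clearance plus `ρ₂ - ρ₁`. The point
`p t` belongs to the wave of radius `ρ`. It is not interior to it, for otherwise `x` would be
interior to the wave of radius `ρ₂`. So `p t` is on a whole interval of wave fronts. -/

/-! ### Mean value inequalities for absolutely continuous curves. -/

section AbsolutelyContinuous

variable {X : Type*} [NormedAddCommGroup X] [NormedSpace ℝ X]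

/-- The composition of an absolutely continuous function with a continuous linear functional is
absolutely continuous. -/
theorem AbsolutelyContinuousOnInterval.clm_comp {p : ℝ → X} {a b : ℝ}
    (hp : AbsolutelyContinuousOnInterval p a b) (l : X →L[ℝ] ℝ) :
    AbsolutelyContinuousOnInterval (fun t => l (p t)) a b := by
  refine squeeze_zero (fun t => Finset.sum_nonneg fun i _ => dist_nonneg) (fun t => ?_)
    (by simpa using Filter.Tendsto.const_mul ‖l‖ hp)
  rw [Finset.mul_sum]
  exact Finset.sum_le_sum fun i _ => l.lipschitz.dist_le_mul _ _

/-- A mean value inequality for absolutely continuous curves, with a weight. -/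
theorem AbsolutelyContinuousOnInterval.clm_sub_le {p : ℝ → X} {a b : ℝ} (hab : a ≤ b)
    (hp : AbsolutelyContinuousOnInterval p a b) (l : X →L[ℝ] ℝ) (u : ℝ) {w : ℝ → ℝ}
    (hw : IntervalIntegrable w volume a b)
    (h : ∀ᵐ t ∂volume.restrict (Icc a b), ∃ v, HasDerivAt p v t ∧ l v ≤ u * w t) :
    l (p b) - l (p a) ≤ u * ∫ t in a..b, w t := by
  have hl := hp.clm_comp l
  rw [← hl.integral_deriv_eq_sub, ← intervalIntegral.integral_const_mul]
  refine intervalIntegral.integral_mono_ae_restrict hab hl.intervalIntegrable_deriv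
    (hw.const_mul u) ?_
  filter_upwards [h] with t ⟨v, hv, hle⟩
  have : HasDerivAt (fun t => l (p t)) (l v) t := l.hasFDerivAt.comp_hasDerivAt t hv
  rw [this.deriv]
  exact hle

/-- The weighted mean velocity of an absolutely continuous curve lies in every closed convex set
that contains the normalized velocities; when the set contains `0`, the total weight may be
overestimated. -/
theorem AbsolutelyContinuousOnInterval.inv_smul_sub_mem {p : ℝ → X} {a b : ℝ} (hab : a ≤ b)
    (hp : AbsolutelyContinuousOnInterval p a b) {C : Set X} (hC : Convex ℝ C) (hC' : IsClosed C)
    {w : ℝ → ℝ} (hw : IntervalIntegrable w volume a b) (hw0 : ∀ t, 0 ≤ w t)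
    (h : ∀ᵐ t ∂volume.restrict (Icc a b), ∃ v ∈ C, HasDerivAt p (w t • v) t)
    {W : ℝ} (hW : 0 < W) (hW' : ∫ t in a..b, w t = W ∨ (0 : X) ∈ C ∧ ∫ t in a..b, w t ≤ W) :
    W⁻¹ • (p b - p a) ∈ C := by
  by_contra hn
  obtain ⟨l, u, hu, hu'⟩ := geometric_hahn_banach_closed_point hC hC' hn
  have h1 : l (p b) - l (p a) ≤ u * ∫ t in a..b, w t := by
    refine hp.clm_sub_le hab l u hw ?_
    filter_upwards [h] with t ⟨v, hv, hd⟩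
    refine ⟨_, hd, ?_⟩
    rw [map_smul, smul_eq_mul, mul_comm]
    exact mul_le_mul_of_nonneg_right (hu v hv).le (hw0 t)
  -- If `0 ∈ C`, the separating level `u` is positive, so enlarging the weight only weakens the
  -- bound.
  have h2 : u * ∫ t in a..b, w t ≤ u * W := by
    rcases hW' with h | ⟨h0, h⟩
    · rw [h]
    · have := hu 0 h0
      rw [map_zero] at this
      exact mul_le_mul_of_nonneg_left h this.le
  rw [map_smul, map_sub, smul_eq_mul, lt_inv_mul_iff₀ hW] at hu'
  linarith

/-- The convex set is a ball. The weight serves both for time (`w = 1`) and, later, for the rate of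
time per unit of cost. -/
theorem AbsolutelyContinuousOnInterval.norm_sub_le {p : ℝ → X} {a b : ℝ} (hab : a ≤ b)
    (hp : AbsolutelyContinuousOnInterval p a b) {M : ℝ} (hM : 0 ≤ M)
    {w : ℝ → ℝ} (hw : IntervalIntegrable w volume a b) (hw0 : ∀ t, 0 ≤ w t)
    (h : ∀ᵐ t ∂volume.restrict (Icc a b), ∃ v, ‖v‖ ≤ M ∧ HasDerivAt p (w t • v) t) :
    ‖p b - p a‖ ≤ M * ∫ t in a..b, w t := by
  have h0 : 0 ≤ ∫ t in a..b, w t := intervalIntegral.integral_nonneg hab fun t _ => hw0 t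
  refine le_of_forall_pos_le_add fun ε hε => ?_
  -- The tolerance keeps the total weight positive when the integral vanishes; `M + 1` covers `M =
  -- 0`.
  have hW : 0 < (∫ t in a..b, w t) + ε / (M + 1) := by positivity
  have := hp.inv_smul_sub_mem hab (convex_closedBall (0 : X) M) Metric.isClosed_closedBall hw hw0
    (by simpa using h) hW (Or.inr ⟨by simpa using hM, by simp; positivity⟩)
  rw [mem_closedBall_zero_iff, norm_smul, norm_inv, Real.norm_of_nonneg hW.le,
    inv_mul_le_iff₀ hW] at this
  have h3 : M * (ε / (M + 1)) ≤ ε := by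
    rw [mul_div_assoc', div_le_iff₀ (by positivity)]
    nlinarith
  nlinarith

end AbsolutelyContinuous

/-- Lipschitz curves can be glued. -/
theorem LipschitzOnWith.Icc_union {X : Type*} [PseudoMetricSpace X] {p : ℝ → X} {a b c : ℝ}
    {K : NNReal} (h1 : LipschitzOnWith K p (Icc a b)) (h2 : LipschitzOnWith K p (Icc b c)) :
    LipschitzOnWith K p (Icc a c) := by
  have key : ∀ s ∈ Icc a c, ∀ t ∈ Icc a c, s ≤ t → Dist.dist (p s) (p t) ≤ K * Dist.dist s t := by
    intro s hs t ht hst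
    rcases le_total t b with h | h
    · exact h1.dist_le_mul s ⟨hs.1, hst.trans h⟩ t ⟨ht.1, h⟩
    rcases le_total b s with h' | h'
    · exact h2.dist_le_mul s ⟨h', hs.2⟩ t ⟨h, ht.2⟩
    have e1 := h1.dist_le_mul s ⟨hs.1, h'⟩ b ⟨hs.1.trans h', le_rfl⟩
    have e2 := h2.dist_le_mul b ⟨le_rfl, h.trans ht.2⟩ t ⟨h, ht.2⟩
    have e3 := dist_triangle (p s) (p b) (p t)
    have : Dist.dist s t = Dist.dist s b + Dist.dist b t := by
      rw [Real.dist_eq, Real.dist_eq, Real.dist_eq, abs_of_nonpos (by linarith),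
        abs_of_nonpos (by linarith), abs_of_nonpos (by linarith)]
      ring
    rw [this, mul_add]
    linarith
  refine LipschitzOnWith.of_dist_le_mul fun s hs t ht => ?_
  rcases le_total s t with h | h
  · exact key s hs t ht h
  · rw [dist_comm, dist_comm s]
    exact key t ht s hs h

/-! ### Trajectories: Lipschitz bounds, cutting, shifting, concatenation, and the triangle
inequality for costs. -/

namespace ControlSystem

variable {X : Type*} [NormedAddCommGroup X] [InnerProductSpace ℝ X] {m : ℕ}
  {S : ControlSystem X m} {x y z : X} {T : ℝ} {p : ℝ → X}

theorem IsUnconstrainedTraj.ae_hasDerivAt (h : S.IsUnconstrainedTraj x y T p) :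
    ∀ᵐ t ∂volume.restrict (Icc 0 T), deriv p t ∈ S.F (p t) ∧ HasDerivAt p (deriv p t) t := by
  obtain ⟨u, hu⟩ := h.ode
  filter_upwards [hu] with t ⟨h1, h2⟩
  rw [h2.deriv]
  exact ⟨⟨u t, h1, rfl⟩, h2⟩

theorem IsUnconstrainedTraj.continuousOn (h : S.IsUnconstrainedTraj x y T p) :
    ContinuousOn p (Icc 0 T) := by
  simpa [uIcc_of_le h.nonneg] using h.ac.continuousOn

/-- A Lipschitz curve with admissible velocities is a trajectory. -/
theorem isTraj_of_lipschitzOnWith (hT : 0 ≤ T) {K : NNReal} (hp : LipschitzOnWith K p (Icc 0 T))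
    (h : ∀ᵐ t ∂volume.restrict (Icc 0 T), ∃ v ∈ S.F (p t), HasDerivAt p v t)
    (hc : ∀ t ∈ Icc 0 T, p t ∈ closure S.free) : S.IsTraj (p 0) (p T) T p where
  nonneg := hT
  ac := LipschitzOnWith.absolutelyContinuousOnInterval (K := K) (by rwa [uIcc_of_le hT])
  ode := by
    classical
    -- The control need not be measurable, so it is chosen pointwise; the value `0` occurs only on a
    -- null set.
    refine ⟨fun t => if ht : ∃ u ∈ S.U, HasDerivAt p (S.f (p t) u) t then ht.choose else 0, ?_⟩
    filter_upwards [h] with t ⟨v, ⟨u, hu, hv⟩, hd⟩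
    have ht : ∃ u ∈ S.U, HasDerivAt p (S.f (p t) u) t := ⟨u, hu, hv ▸ hd⟩
    simp only [dif_pos ht]
    exact ht.choose_spec
  start := rfl
  finish := rfl
  mem_closure := hc

theorem IsUnconstrainedTraj.exists_bound (h : S.IsUnconstrainedTraj x y T p) (hS : S.Standing) :
    ∃ M > (0 : ℝ), ∀ t ∈ Icc 0 T, ∀ v ∈ S.F (p t), ‖v‖ ≤ M := by
  obtain ⟨M, hM, hb⟩ := hS.F_bounded _ (isCompact_Icc.image_of_continuousOn h.continuousOn)
  exact ⟨M, hM, fun t ht => hb _ (mem_image_of_mem p ht)⟩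

/-- `F` is bounded over the compact image of the curve. Unlike absolute continuity, a Lipschitz
bound is immediate to shift and to glue. -/
theorem IsUnconstrainedTraj.exists_lipschitzOnWith (h : S.IsUnconstrainedTraj x y T p)
    (hS : S.Standing) : ∃ K, LipschitzOnWith K p (Icc 0 T) := by
  obtain ⟨M, hM, hb⟩ := h.exists_bound hS
  have key : ∀ s ∈ Icc 0 T, ∀ t ∈ Icc 0 T, s ≤ t → ‖p t - p s‖ ≤ M * (t - s) := by
    intro s hs t ht hst
    have hsub : Icc s t ⊆ Icc 0 T := Icc_subset_Icc hs.1 ht.2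
    have := AbsolutelyContinuousOnInterval.norm_sub_le hst
      (h.ac.mono (by rwa [uIcc_of_le hst, uIcc_of_le h.nonneg])) hM.le (w := fun _ => 1)
      (by simp) (by simp) (by
        filter_upwards [ae_restrict_of_ae_restrict_of_subset hsub h.ae_hasDerivAt,
          ae_restrict_mem measurableSet_Icc] with r hr hr'
        exact ⟨deriv p r, hb r (hsub hr') _ hr.1, by simpa using hr.2⟩)
    simpa using this
  refine ⟨⟨M, hM.le⟩, LipschitzOnWith.of_dist_le_mul fun s hs t ht => ?_⟩
  rcases le_total s t with hst | hst
  · rw [dist_comm, dist_eq_norm, dist_comm, Real.dist_eq, abs_of_nonneg (by linarith)]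
    exact key s hs t ht hst
  · rw [dist_eq_norm, Real.dist_eq, abs_of_nonneg (by linarith)]
    exact key t ht s hs hst

theorem IsTraj.take (h : S.IsTraj x y T p) {t : ℝ} (ht : t ∈ Icc 0 T) : S.IsTraj x (p t) t p where
  nonneg := ht.1
  ac := h.ac.mono (by
    rw [uIcc_of_le ht.1, uIcc_of_le h.nonneg]; exact Icc_subset_Icc_right ht.2)
  ode := by
    obtain ⟨u, hu⟩ := h.ode
    exact ⟨u, ae_restrict_of_ae_restrict_of_subset (Icc_subset_Icc_right ht.2) hu⟩
  start := h.start
  finish := rfl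
  mem_closure s hs := h.mem_closure s ⟨hs.1, hs.2.trans ht.2⟩

theorem ae_restrict_Icc_add_left {P : ℝ → Prop} {a b t : ℝ}
    (h : ∀ᵐ s ∂volume.restrict (Icc (t + a) (t + b)), P s) :
    ∀ᵐ s ∂volume.restrict (Icc a b), P (t + s) := by
  rw [ae_restrict_iff' measurableSet_Icc] at h ⊢
  filter_upwards [(measurePreserving_add_left volume t).quasiMeasurePreserving.ae h] with s hs hs'
  exact hs ⟨by linarith [hs'.1], by linarith [hs'.2]⟩

theorem IsTraj.drop (h : S.IsTraj x y T p) (hS : S.Standing) {t : ℝ} (ht : t ∈ Icc 0 T) :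
    S.IsTraj (p t) y (T - t) (fun s => p (t + s)) := by
  obtain ⟨K, hK⟩ := h.exists_lipschitzOnWith hS
  have hm : ∀ s ∈ Icc 0 (T - t), t + s ∈ Icc 0 T := fun s hs =>
    ⟨by linarith [hs.1, ht.1], by linarith [hs.2]⟩
  have := isTraj_of_lipschitzOnWith (S := S) (p := fun s => p (t + s)) (T := T - t) (K := K)
    (by linarith [ht.2])
    (LipschitzOnWith.of_dist_le_mul fun r hr s hs => by
      simpa using hK.dist_le_mul _ (hm r hr) _ (hm s hs)) (by
      have h1 := ae_restrict_of_ae_restrict_of_subset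
        (s := Icc (t + 0) (t + (T - t))) (t := Icc 0 T)
        (Icc_subset_Icc (by linarith [ht.1]) (by linarith)) h.ae_hasDerivAt
      filter_upwards [ae_restrict_Icc_add_left h1] with s hs
      exact ⟨_, hs.1, hs.2.comp_const_add t s⟩)
    (fun s hs => h.mem_closure _ (hm s hs))
  simpa [h.finish] using this

theorem setLIntegral_Icc_add_left (g : ℝ → ℝ≥0∞) (a b t : ℝ) :
    ∫⁻ s in Icc a b, g (t + s) = ∫⁻ s in Icc (t + a) (t + b), g s := by
  have := (measurePreserving_add_left volume t).setLIntegral_comp_preimage_emb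
    (measurableEmbedding_addLeft t) g (Icc (t + a) (t + b))
  rw [← this]
  congr 2
  ext s
  simp

theorem cost_eq_add (S : ControlSystem X m) (p : ℝ → X) {t : ℝ} (ht : t ∈ Icc 0 T) :
    S.cost T p = S.cost t p + S.cost (T - t) (fun s => p (t + s)) := by
  unfold cost
  simp only [deriv_comp_const_add]
  rw [setLIntegral_Icc_add_left (fun s => ENNReal.ofReal (S.ψ (p s) (deriv p s)))]
  rw [add_zero, add_sub_cancel, ← setLIntegral_congr (Ioc_ae_eq_Icc (a := t) (b := T)),
    ← lintegral_union measurableSet_Ioc]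
  · rw [Icc_union_Ioc_eq_Icc ht.1 ht.2]
  · rw [Set.disjoint_left]
    exact fun s hs hs' => absurd hs.2 (not_le.2 hs'.1)

theorem dist_le_cost (h : S.IsTraj x y T p) : S.dist x y ≤ S.cost T p :=
  iInf_le_of_le T (iInf_le_of_le p (iInf_le _ h))

/-- Agreement on the open interval also gives equal derivatives there, and the end points are null.
-/
theorem cost_congr {q : ℝ → X} (h : ∀ t ∈ Ioo 0 T, p t = q t) : S.cost T p = S.cost T q := by
  unfold cost
  rw [← setLIntegral_congr (Ioo_ae_eq_Icc (a := 0) (b := T))]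
  rw [← setLIntegral_congr (Ioo_ae_eq_Icc (a := 0) (b := T))]
  refine setLIntegral_congr_fun measurableSet_Ioo fun t ht => ?_
  have : p =ᶠ[nhds t] q := by
    filter_upwards [isOpen_Ioo.mem_nhds ht] with s hs using h s hs
  rw [this.deriv_eq, h t ht]

theorem ae_restrict_congr {q : ℝ → X} (hpq : ∀ t ∈ Ioo 0 T, p t = q t)
    (h : ∀ᵐ t ∂volume.restrict (Icc 0 T), ∃ v ∈ S.F (p t), HasDerivAt p v t) :
    ∀ᵐ t ∂volume.restrict (Icc 0 T), ∃ v ∈ S.F (q t), HasDerivAt q v t := by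
  rw [← restrict_Ioo_eq_restrict_Icc] at h ⊢
  filter_upwards [h, ae_restrict_mem measurableSet_Ioo] with t ⟨v, hv, hd⟩ ht
  refine ⟨v, hpq t ht ▸ hv, hd.congr_of_eventuallyEq ?_⟩
  filter_upwards [isOpen_Ioo.mem_nhds ht] with s hs using (hpq s hs).symm

/-- Concatenation of trajectories. -/
theorem IsTraj.exists_append (hS : S.Standing) (h : S.IsTraj x z T p) {T' : ℝ} {q : ℝ → X}
    (h' : S.IsTraj z y T' q) :
    ∃ r, S.IsTraj x y (T + T') r ∧ S.cost (T + T') r = S.cost T p + S.cost T' q := by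
  obtain ⟨K, hK⟩ := h.exists_lipschitzOnWith hS
  obtain ⟨K', hK'⟩ := h'.exists_lipschitzOnWith hS
  have hT := h.nonneg
  have hT' := h'.nonneg
  let r : ℝ → X := fun t => if t ≤ T then p t else q (t - T)
  have hrp : ∀ t ≤ T, r t = p t := fun t ht => if_pos ht
  have hrq : ∀ s, 0 ≤ s → r (T + s) = q s := by
    intro s hs
    rcases hs.eq_or_lt with rfl | hs
    · rw [add_zero, hrp T le_rfl, h.finish, h'.start]
    · simp only [r]
      rw [if_neg (by linarith), add_sub_cancel_left]
  have hcost : S.cost (T + T') r = S.cost T p + S.cost T' q := by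
    rw [cost_eq_add S r (t := T) ⟨hT, by linarith⟩, add_sub_cancel_left,
      cost_congr (p := r) (q := p) fun t ht => hrp t ht.2.le,
      cost_congr (p := fun s => r (T + s)) (q := q) fun t ht => hrq t ht.1.le]
  refine ⟨r, ?_, hcost⟩
  have hL : LipschitzOnWith (max K K') r (Icc 0 (T + T')) := by
    refine LipschitzOnWith.Icc_union (b := T) ?_ ?_
    · refine LipschitzOnWith.weaken (K := K) (LipschitzOnWith.of_dist_le_mul fun s hs t ht => ?_)
        (le_max_left _ _)
      rw [hrp s hs.2, hrp t ht.2]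
      exact hK.dist_le_mul s hs t ht
    · refine LipschitzOnWith.weaken (K := K') (LipschitzOnWith.of_dist_le_mul fun s hs t ht => ?_)
        (le_max_right _ _)
      have e1 := hrq (s - T) (by linarith [hs.1])
      have e2 := hrq (t - T) (by linarith [ht.1])
      rw [add_sub_cancel] at e1 e2
      rw [e1, e2]
      simpa using hK'.dist_le_mul (s - T) ⟨by linarith [hs.1], by linarith [hs.2]⟩ (t - T)
        ⟨by linarith [ht.1], by linarith [ht.2]⟩
  have hae : ∀ᵐ t ∂volume.restrict (Icc 0 (T + T')), ∃ v ∈ S.F (r t), HasDerivAt r v t := by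
    rw [← Icc_union_Icc_eq_Icc hT (by linarith : T ≤ T + T'), ae_restrict_union_iff]
    constructor
    · refine ae_restrict_congr (p := p) (fun t ht => (hrp t ht.2.le).symm) ?_
      filter_upwards [h.ae_hasDerivAt] with t ht using ⟨_, ht⟩
    · have h1 : ∀ᵐ s ∂volume.restrict (Icc 0 T'),
          ∃ v ∈ S.F (r (T + s)), HasDerivAt (fun s => r (T + s)) v s := by
        refine ae_restrict_congr (p := q) (fun t ht => (hrq t ht.1.le).symm) ?_
        filter_upwards [h'.ae_hasDerivAt] with t ht using ⟨_, ht⟩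
      -- The interval is written so that the shift by `-T` carries the second piece back to `[T, T +
      -- T']`.
      have h2 : ∀ᵐ s ∂volume.restrict (Icc (-T + T) (-T + (T + T'))),
          ∃ v ∈ S.F (r (T + s)), HasDerivAt (fun s => r (T + s)) v s := by
        simpa using h1
      filter_upwards [ae_restrict_Icc_add_left h2] with s ⟨v, hv, hd⟩
      refine ⟨v, by simpa using hv, ?_⟩
      have := hd.comp_const_add (-T) s
      simpa using this
  have hmem : ∀ t ∈ Icc 0 (T + T'), r t ∈ closure S.free := by
    intro t ht
    rcases le_total t T with h1 | h1
    · rw [hrp t h1]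
      exact h.mem_closure t ⟨ht.1, h1⟩
    · have e1 := hrq (t - T) (by linarith)
      rw [add_sub_cancel] at e1
      rw [e1]
      exact h'.mem_closure _ ⟨by linarith, by linarith [ht.2]⟩
  have := isTraj_of_lipschitzOnWith (by linarith) hL hae hmem
  rwa [hrp 0 hT, h.start, hrq T' hT', h'.finish] at this

theorem dist_le_cost_add (hS : S.Standing) (h : S.IsTraj x z T p) (y : X) :
    S.dist x y ≤ S.cost T p + S.dist z y := by
  -- Truncated subtraction isolates the infimum, infinite values included.
  rw [← tsub_le_iff_left]
  refine le_iInf fun T' => le_iInf fun q => le_iInf fun hq => ?_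
  rw [tsub_le_iff_left]
  obtain ⟨r, hr, hc⟩ := h.exists_append hS hq
  exact hc ▸ dist_le_cost hr

theorem clr_le_cost_add (hS : S.Standing) (h : S.IsTraj x z T p) :
    S.clr x ≤ S.cost T p + S.clr z := by
  rw [← tsub_le_iff_left]
  refine le_iInf fun y => le_iInf fun hy => ?_
  rw [tsub_le_iff_left]
  exact (iInf_le_of_le y (iInf_le _ hy)).trans (dist_le_cost_add hS h y)

end ControlSystem

/-! ### Tools for Filippov's theorem: the fundamental theorem of calculus and the nearest admissible
velocity. -/

section AbsolutelyContinuous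

variable {X : Type*} [NormedAddCommGroup X] [NormedSpace ℝ X] [CompleteSpace X]

/-- The fundamental theorem of calculus for absolutely continuous curves. -/
theorem AbsolutelyContinuousOnInterval.integral_eq_sub_of_ae_hasDerivAt {p g : ℝ → X} {a b : ℝ}
    (hab : a ≤ b) (hp : AbsolutelyContinuousOnInterval p a b)
    (hg : IntervalIntegrable g volume a b)
    (h : ∀ᵐ t ∂volume.restrict (Icc a b), HasDerivAt p (g t) t) :
    ∫ t in a..b, g t = p b - p a := by
  refine (SeparatingDual.eq_iff_forall_dual_eq (R := ℝ)).2 fun l => ?_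
  rw [← l.intervalIntegral_comp_comm hg, map_sub, ← (hp.clm_comp l).integral_deriv_eq_sub]
  refine intervalIntegral.integral_congr_ae_restrict ?_
  rw [uIoc_of_le hab]
  filter_upwards [ae_restrict_of_ae_restrict_of_subset Ioc_subset_Icc_self h] with t ht
  exact (l.hasFDerivAt.comp_hasDerivAt t ht : HasDerivAt (fun t => l (p t)) (l (g t)) t).deriv.symm

end AbsolutelyContinuous

namespace ControlSystem

variable {X : Type*} [NormedAddCommGroup X] [InnerProductSpace ℝ X] {m : ℕ}
  {S : ControlSystem X m}

theorem Standing.isClosed_F (hS : S.Standing) (x : X) : IsClosed (S.F x) :=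
  hS.F_closed_graph.preimage (Continuous.prodMk_right x)

theorem Standing.exists_norm_sub_le (hS : S.Standing) {K : Set X} (hK : IsCompact K) :
    ∃ k > (0 : ℝ), ∀ x ∈ K, ∀ y ∈ K, ∀ v ∈ S.F x, ∃ w ∈ S.F y, ‖v - w‖ ≤ k * ‖x - y‖ := by
  obtain ⟨k, hk, h⟩ := hS.F_lipschitz K hK
  refine ⟨k, hk, fun x hx y hy v hv => ?_⟩
  obtain ⟨w, hw, e, he, rfl⟩ := h x hx y hy hv
  obtain ⟨b, hb, rfl⟩ := he
  refine ⟨w, hw, ?_⟩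
  rw [mem_closedBall_zero_iff] at hb
  simp only [add_sub_cancel_left]
  rw [norm_smul, Real.norm_of_nonneg (by positivity)]
  exact mul_le_of_le_one_right (by positivity) hb

open Classical in
/-- The admissible velocity at `x` that is nearest to `v`. -/
noncomputable def nearest (S : ControlSystem X m) (q : X × X) : X :=
  if h : ∃ w ∈ S.F q.1, ∀ u ∈ S.F q.1, inner ℝ (q.2 - w) (u - w) ≤ 0 then h.choose else 0

variable [FiniteDimensional ℝ X]

theorem Standing.nearest_spec (hS : S.Standing) (q : X × X) :
    S.nearest q ∈ S.F q.1 ∧ ∀ u ∈ S.F q.1, inner ℝ (q.2 - S.nearest q) (u - S.nearest q) ≤ 0 := by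
  have : CompleteSpace X := FiniteDimensional.complete ℝ X
  have h : ∃ w ∈ S.F q.1, ∀ u ∈ S.F q.1, inner ℝ (q.2 - w) (u - w) ≤ 0 := by
    obtain ⟨w, hw, h⟩ := exists_norm_eq_iInf_of_complete_convex (hS.F_nonempty q.1)
      (hS.isClosed_F q.1).isComplete (hS.F_convex q.1) q.2
    exact ⟨w, hw, (norm_eq_iInf_iff_real_inner_le_zero (hS.F_convex q.1) hw).1 h⟩
  rw [nearest, dif_pos h]
  exact h.choose_spec

theorem Standing.nearest_mem (hS : S.Standing) (q : X × X) : S.nearest q ∈ S.F q.1 :=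
  (hS.nearest_spec q).1

theorem Standing.norm_sub_nearest_le (hS : S.Standing) (q : X × X) {u : X} (hu : u ∈ S.F q.1) :
    ‖q.2 - S.nearest q‖ ≤ ‖q.2 - u‖ := by
  have h := (hS.nearest_spec q).2 u hu
  have h1 : ‖q.2 - S.nearest q‖ * ‖q.2 - S.nearest q‖ ≤ ‖q.2 - S.nearest q‖ * ‖q.2 - u‖ := by
    refine le_trans ?_ (real_inner_le_norm _ _)
    have e : q.2 - u = (q.2 - S.nearest q) - (u - S.nearest q) := by abel
    rw [e, inner_sub_right, real_inner_self_eq_norm_mul_norm]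
    linarith
  rcases (norm_nonneg (q.2 - S.nearest q)).eq_or_lt with h0 | h0
  · rw [← h0]; positivity
  · exact le_of_mul_le_mul_left h1 h0

theorem Standing.nearest_eq_self (hS : S.Standing) {x v : X} (hv : v ∈ S.F x) :
    S.nearest (x, v) = v := by
  have := hS.norm_sub_nearest_le (x, v) hv
  simp only [sub_self, norm_zero, norm_le_zero_iff] at this
  exact (sub_eq_zero.1 this).symm

/-- The variational inequalities at two base points are compared after moving each minimizer into
the other velocity set by the Lipschitz property. Continuity is what makes the iterated velocities
measurable. -/
theorem Standing.continuous_nearest (hS : S.Standing) : Continuous S.nearest := by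
  have : ProperSpace X := FiniteDimensional.proper_real X
  rw [continuous_iff_continuousAt]
  rintro ⟨x, v⟩
  have hK := isCompact_closedBall x (1 : ℝ)
  obtain ⟨M, hM, hMb⟩ := hS.F_bounded _ hK
  obtain ⟨k, hk, hkb⟩ := hS.exists_norm_sub_le hK
  have hx : x ∈ Metric.closedBall x 1 := Metric.mem_closedBall_self zero_le_one
  have key : ∀ y ∈ Metric.closedBall x 1, ∀ w, ‖S.nearest (y, w) - S.nearest (x, v)‖ ^ 2 ≤
      ‖w - v‖ * (2 * M) + k * ‖y - x‖ * (‖v‖ + M + (‖w‖ + M)) := by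
    intro y hy w
    set a := S.nearest (x, v) with ha
    set b := S.nearest (y, w) with hb
    have haF : a ∈ S.F x := hS.nearest_mem (x, v)
    have hbF : b ∈ S.F y := hS.nearest_mem (y, w)
    have haM := hMb x hx a haF
    have hbM := hMb y hy b hbF
    obtain ⟨a', ha', haa⟩ := hkb x hx y hy a haF
    obtain ⟨b', hb', hbb⟩ := hkb y hy x hx b hbF
    have h1 := (hS.nearest_spec (x, v)).2 b' hb'
    have h2 := (hS.nearest_spec (y, w)).2 a' ha'
    rw [← ha] at h1
    rw [← hb] at h2
    simp only at h1 h2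
    -- The second and fourth terms are nonpositive by `h1` and `h2`; the other three are small.
    have e : ‖b - a‖ ^ 2 = inner ℝ (w - v) (b - a) + inner ℝ (v - a) (b' - a)
        + inner ℝ (v - a) (b - b') + inner ℝ (w - b) (a' - b) + inner ℝ (w - b) (a - a') := by
      rw [← real_inner_self_eq_norm_sq]
      simp only [inner_sub_left, inner_sub_right]
      ring
    have i1 : inner ℝ (w - v) (b - a) ≤ ‖w - v‖ * (2 * M) :=
      (real_inner_le_norm _ _).trans (mul_le_mul_of_nonneg_left
        ((norm_sub_le _ _).trans (by linarith)) (norm_nonneg _))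
    have i2 : inner ℝ (v - a) (b - b') ≤ (‖v‖ + M) * (k * ‖y - x‖) :=
      (real_inner_le_norm _ _).trans (mul_le_mul ((norm_sub_le _ _).trans (by linarith)) hbb
        (norm_nonneg _) (by positivity))
    have i3 : inner ℝ (w - b) (a - a') ≤ (‖w‖ + M) * (k * ‖y - x‖) :=
      (real_inner_le_norm _ _).trans (mul_le_mul ((norm_sub_le _ _).trans (by linarith))
        (by rwa [norm_sub_rev y x]) (norm_nonneg _) (by positivity))
    rw [e]
    linarith
  have hlim : Filter.Tendsto (fun q : X × X =>
      ‖q.2 - v‖ * (2 * M) + k * ‖q.1 - x‖ * (‖v‖ + M + (‖q.2‖ + M))) (nhds (x, v)) (nhds 0) := by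
    have : Continuous (fun q : X × X =>
      ‖q.2 - v‖ * (2 * M) + k * ‖q.1 - x‖ * (‖v‖ + M + (‖q.2‖ + M))) := by fun_prop
    simpa using this.tendsto (x, v)
  have hsq : Filter.Tendsto (fun q : X × X => ‖S.nearest q - S.nearest (x, v)‖ ^ 2)
      (nhds (x, v)) (nhds 0) := by
    refine squeeze_zero' (Filter.Eventually.of_forall fun q => by positivity) ?_ hlim
    have : ∀ᶠ q : X × X in nhds (x, v), q.1 ∈ Metric.closedBall x 1 :=
      continuous_fst.continuousAt.eventually (Metric.closedBall_mem_nhds x one_pos)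
    filter_upwards [this] with q hq using key q.1 hq q.2
  rw [ContinuousAt, tendsto_iff_norm_sub_tendsto_zero]
  have := (Real.continuous_sqrt.tendsto 0).comp hsq
  simpa [Function.comp_def, Real.sqrt_sq (norm_nonneg _)] using this

end ControlSystem

/-! ### Filippov's iteration. -/

namespace ControlSystem

theorem intervalIntegrable_of_norm_le {X : Type*} [NormedAddCommGroup X] {v : ℝ → X}
    (hv : StronglyMeasurable v) {M : ℝ}
    (hM : ∀ t, ‖v t‖ ≤ M) (a b : ℝ) : IntervalIntegrable v volume a b :=
  (intervalIntegrable_const (c := M)).mono_fun hv.aestronglyMeasurable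
    (Filter.Eventually.of_forall fun t => (hM t).trans (le_abs_self M))

theorem lipschitzWith_integral_of_norm_le {X : Type*} [NormedAddCommGroup X] [NormedSpace ℝ X]
    {v : ℝ → X} (hv : StronglyMeasurable v) {M : NNReal}
    (hM : ∀ t, ‖v t‖ ≤ M) (x : X) : LipschitzWith M fun t => x + ∫ s in (0 : ℝ)..t, v s := by
  refine LipschitzWith.of_dist_le_mul fun a b => ?_
  rw [dist_eq_norm, Real.dist_eq, add_sub_add_left_eq_sub,
    intervalIntegral.integral_interval_sub_left (intervalIntegrable_of_norm_le hv hM _ _)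
      (intervalIntegrable_of_norm_le hv hM _ _)]
  exact intervalIntegral.norm_integral_le_of_norm_le_const fun t _ => hM t

variable {X : Type*} [NormedAddCommGroup X] [InnerProductSpace ℝ X] {m : ℕ}
  {S : ControlSystem X m}

/-- Picard iterates for a trajectory from `x'` that follows the curve `p` on `[0,T]`: the
positions and the velocities. -/
noncomputable def picard (S : ControlSystem X m) (T : ℝ) (x' : X) (p : ℝ → X) :
    ℕ → (ℝ → X) × (ℝ → X)
  -- Clamping time to `[0,T]` makes the positions globally continuous. Each new velocity is the one
  -- nearest to the previous velocity, so it changes by at most the Lipschitz constant times the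
  -- change of position.
  | 0 => (fun t => p (max 0 (min T t)), fun t => S.nearest (p (max 0 (min T t)), deriv p t))
  | n + 1 => (fun t => x' + ∫ s in (0 : ℝ)..max 0 (min T t), (picard S T x' p n).2 s,
      fun t => S.nearest (x' + ∫ s in (0 : ℝ)..max 0 (min T t), (picard S T x' p n).2 s,
        (picard S T x' p n).2 t))

variable [FiniteDimensional ℝ X]

theorem picard_snd_mem (hS : S.Standing) (T : ℝ) (x' : X) (p : ℝ → X) (n : ℕ) (t : ℝ) :
    (S.picard T x' p n).2 t ∈ S.F ((S.picard T x' p n).1 t) := by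
  cases n
  · exact hS.nearest_mem (p _, deriv p t)
  · exact hS.nearest_mem (x' + ∫ s in (0 : ℝ)..max 0 (min T t), _, _)

theorem clamp_mem {T : ℝ} (hT : 0 ≤ T) (t : ℝ) : max 0 (min T t) ∈ Icc 0 T :=
  ⟨le_max_left _ _, max_le hT (min_le_left _ _)⟩

theorem clamp_eq {T t : ℝ} (ht : t ∈ Icc 0 T) : max 0 (min T t) = t := by
  rw [min_eq_right ht.2, max_eq_right ht.1]

/-- Only velocities of index below `n` are assumed bounded, so that this can be used inside the
induction that proves the bounds. -/
theorem picard_measurable (hS : S.Standing) {T : ℝ} {M : NNReal} (x' : X) {p : ℝ → X} (hT : 0 ≤ T)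
    (hp : ContinuousOn p (Icc 0 T)) (n : ℕ)
    (hM : ∀ k < n, ∀ t, ‖(S.picard T x' p k).2 t‖ ≤ M) :
    Continuous (S.picard T x' p n).1 ∧ StronglyMeasurable (S.picard T x' p n).2 := by
  have hc : Continuous fun t : ℝ => max 0 (min T t) := by fun_prop
  have : CompleteSpace X := FiniteDimensional.complete ℝ X
  induction n with
  | zero =>
    have h0 : Continuous fun t => p (max 0 (min T t)) :=
      hp.comp_continuous hc (clamp_mem hT)
    exact ⟨h0, hS.continuous_nearest.comp_stronglyMeasurable
      (h0.stronglyMeasurable.prodMk (stronglyMeasurable_deriv p))⟩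
  | succ n ih =>
    have ih := ih fun k hk => hM k (hk.trans n.lt_succ_self)
    have h0 : Continuous fun t => x' + ∫ s in (0 : ℝ)..max 0 (min T t), (S.picard T x' p n).2 s :=
      (lipschitzWith_integral_of_norm_le ih.2 (hM n n.lt_succ_self) x').continuous.comp hc
    exact ⟨h0, hS.continuous_nearest.comp_stronglyMeasurable (h0.stronglyMeasurable.prodMk ih.2)⟩

/-- The contraction estimate for the Picard iterates. -/
theorem picard_estimate (hS : S.Standing) {x y : X} {T : ℝ} {p : ℝ → X}
    (h : S.IsUnconstrainedTraj x y T p) {R k M : ℝ}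
    (hR : ∀ t ∈ Icc 0 T, ‖p t‖ ≤ R)
    (hk0 : 0 < k) (hk : ∀ x ∈ Metric.closedBall (0 : X) (R + 1),
      ∀ y ∈ Metric.closedBall (0 : X) (R + 1), ∀ v ∈ S.F x, ∃ w ∈ S.F y, ‖v - w‖ ≤ k * ‖x - y‖)
    (hM0 : 0 ≤ M) (hM : ∀ x ∈ Metric.closedBall (0 : X) (R + 1), ∀ v ∈ S.F x, ‖v‖ ≤ M)
    {x' : X} (hx' : 2 * (‖x' - x‖ * Real.exp (2 * k * T)) ≤ 1) (n : ℕ) :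
    (∀ j ≤ n, ∀ t, ‖(S.picard T x' p j).1 t - (S.picard T x' p 0).1 t‖ ≤
        2 * (‖x' - x‖ * Real.exp (2 * k * T)) * (1 - (1 / 2) ^ j)) ∧
      ∀ t, ‖(S.picard T x' p (n + 1)).1 t - (S.picard T x' p n).1 t‖ ≤
        ‖x' - x‖ * (1 / 2) ^ n * Real.exp (2 * k * max 0 (min T t)) := by
  have : CompleteSpace X := FiniteDimensional.complete ℝ X
  have hT := h.nonneg
  set A := ‖x' - x‖ * Real.exp (2 * k * T) with hA
  have hA0 : 0 ≤ A := by positivity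
  -- Since `2 * A ≤ 1`, the iterates stay in the ball of radius `R + 1`, where `k` and `M` are
  -- valid.
  have hball : ∀ j, (∀ t, ‖(S.picard T x' p j).1 t - (S.picard T x' p 0).1 t‖ ≤
      2 * A * (1 - (1 / 2) ^ j)) → ∀ t, (S.picard T x' p j).1 t ∈ Metric.closedBall 0 (R + 1) := by
    intro j hj t
    rw [mem_closedBall_zero_iff]
    have h1 := hj t
    have h2 : ‖(S.picard T x' p 0).1 t‖ ≤ R := hR _ (clamp_mem hT t)
    have h3 : 2 * A * (1 - (1 / 2) ^ j) ≤ 1 := by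
      have : (0 : ℝ) ≤ (1 / 2) ^ j := by positivity
      nlinarith
    have := norm_le_norm_add_norm_sub' ((S.picard T x' p j).1 t) ((S.picard T x' p 0).1 t)
    linarith
  have hbd : ∀ j, (∀ t, ‖(S.picard T x' p j).1 t - (S.picard T x' p 0).1 t‖ ≤
      2 * A * (1 - (1 / 2) ^ j)) → ∀ t, ‖(S.picard T x' p j).2 t‖ ≤ M := fun j hj t =>
    hM _ (hball j hj t) _ (picard_snd_mem hS T x' p j t)
  have hmeas : ∀ n, (∀ j ≤ n, ∀ t, ‖(S.picard T x' p j).1 t - (S.picard T x' p 0).1 t‖ ≤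
      2 * A * (1 - (1 / 2) ^ j)) → ∀ j ≤ n, ∀ a b,
        IntervalIntegrable (S.picard T x' p j).2 volume a b := by
    intro n hn j hj
    exact intervalIntegrable_of_norm_le (picard_measurable hS (M := ⟨M, hM0⟩) x' hT h.continuousOn
      j fun i hi => hbd i (hn i (hi.le.trans hj))).2 (hbd j (hn j hj))
  induction n with
  | zero =>
    have h0 : ∀ j ≤ 0, ∀ t, ‖(S.picard T x' p j).1 t - (S.picard T x' p 0).1 t‖ ≤
        2 * A * (1 - (1 / 2) ^ j) := by
      intro j hj t
      obtain rfl : j = 0 := by omega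
      simp
    refine ⟨h0, fun t => ?_⟩
    have hct := clamp_mem hT t
    -- The initial velocity is `deriv p` almost everywhere, so the first correction is exactly `x' -
    -- x`.
    have hint : ∫ s in (0 : ℝ)..max 0 (min T t), (S.picard T x' p 0).2 s =
        p (max 0 (min T t)) - p 0 := by
      refine AbsolutelyContinuousOnInterval.integral_eq_sub_of_ae_hasDerivAt hct.1
        (h.ac.mono ?_) (hmeas 0 h0 0 le_rfl _ _) ?_
      · rw [uIcc_of_le hct.1, uIcc_of_le hT]
        exact Icc_subset_Icc_right hct.2
      · have hsub : Icc 0 (max 0 (min T t)) ⊆ Icc 0 T := Icc_subset_Icc_right hct.2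
        filter_upwards [ae_restrict_of_ae_restrict_of_subset hsub h.ae_hasDerivAt,
          ae_restrict_mem measurableSet_Icc] with s hs hs'
        have e : (S.picard T x' p 0).2 s = deriv p s := by
          simp only [picard]
          rw [clamp_eq (hsub hs')]
          exact hS.nearest_eq_self hs.1
        rw [e]
        exact hs.2
    have e : (S.picard T x' p (0 + 1)).1 t - (S.picard T x' p 0).1 t = x' - x := by
      have : (S.picard T x' p (0 + 1)).1 t =
        x' + ∫ s in (0 : ℝ)..max 0 (min T t), (S.picard T x' p 0).2 s := rfl
      rw [this, hint, h.start]
      simp only [picard]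
      abel
    rw [e, pow_zero, mul_one]
    exact le_mul_of_one_le_right (norm_nonneg _) (Real.one_le_exp (by have := hct.1; positivity))
  | succ n ih =>
    obtain ⟨ih1, ih2⟩ := ih
    have h1 : ∀ j ≤ n + 1, ∀ t, ‖(S.picard T x' p j).1 t - (S.picard T x' p 0).1 t‖ ≤
        2 * A * (1 - (1 / 2) ^ j) := by
      intro j hj t
      rcases hj.lt_or_eq with hj | rfl
      · exact ih1 j (by omega) t
      have e1 := ih1 n le_rfl t
      have e2 : ‖(S.picard T x' p (n + 1)).1 t - (S.picard T x' p n).1 t‖ ≤ A * (1 / 2) ^ n := by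
        refine (ih2 t).trans ?_
        rw [hA, mul_right_comm]
        gcongr
        exact (clamp_mem hT t).2
      have e3 := norm_sub_le_norm_sub_add_norm_sub ((S.picard T x' p (n + 1)).1 t)
        ((S.picard T x' p n).1 t) ((S.picard T x' p 0).1 t)
      refine (e3.trans (add_le_add e2 e1)).trans (le_of_eq ?_)
      rw [pow_succ]
      ring
    refine ⟨h1, fun t => ?_⟩
    have hct := clamp_mem hT t
    have e : (S.picard T x' p (n + 1 + 1)).1 t - (S.picard T x' p (n + 1)).1 t =
        ∫ s in (0 : ℝ)..max 0 (min T t),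
          ((S.picard T x' p (n + 1)).2 s - (S.picard T x' p n).2 s) := by
      rw [intervalIntegral.integral_sub (hmeas _ h1 _ le_rfl _ _) (hmeas _ h1 _ n.le_succ _ _)]
      exact add_sub_add_left_eq_sub _ _ _
    -- The exponent `2 * k` is chosen so that integrating `k * exp (2 * k * s)` gains a factor `1 /
    -- 2`, whatever the length of `[0,T]`.
    have hderiv : ∀ s : ℝ, HasDerivAt (fun s => ‖x' - x‖ * (1 / 2) ^ (n + 1) * Real.exp (2 * k * s))
        (k * (‖x' - x‖ * (1 / 2) ^ n * Real.exp (2 * k * s))) s := by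
      intro s
      have := ((((hasDerivAt_id s).const_mul (2 * k)).exp).const_mul (‖x' - x‖ * (1 / 2) ^ (n + 1)))
      convert! this using 1
      simp only [id, pow_succ]
      ring
    rw [e]
    refine (intervalIntegral.norm_integral_le_of_norm_le hct.1
      (g := fun s => k * (‖x' - x‖ * (1 / 2) ^ n * Real.exp (2 * k * s))) ?_ ?_).trans ?_
    · refine Filter.Eventually.of_forall fun s hs => ?_
      have hs' : s ∈ Icc 0 T := ⟨hs.1.le, hs.2.trans hct.2⟩
      obtain ⟨w, hw, hle⟩ := hk _ (hball n (h1 n n.le_succ) s) _ (hball (n + 1) (h1 _ le_rfl) s) _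
        (picard_snd_mem hS T x' p n s)
      have e1 := hS.norm_sub_nearest_le ((S.picard T x' p (n + 1)).1 s, (S.picard T x' p n).2 s) hw
      have e2 : S.nearest ((S.picard T x' p (n + 1)).1 s, (S.picard T x' p n).2 s) =
        (S.picard T x' p (n + 1)).2 s := rfl
      rw [e2] at e1
      rw [norm_sub_rev]
      refine (e1.trans hle).trans ?_
      rw [norm_sub_rev]
      have := ih2 s
      rw [clamp_eq hs'] at this
      exact mul_le_mul_of_nonneg_left this hk0.le
    · exact Continuous.intervalIntegrable (by fun_prop) _ _
    · rw [intervalIntegral.integral_eq_sub_of_hasDerivAt (fun s _ => hderiv s)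
        (Continuous.intervalIntegrable (by fun_prop) _ _)]
      have : 0 ≤ ‖x' - x‖ * (1 / 2) ^ (n + 1) * Real.exp (2 * k * 0) := by positivity
      linarith

end ControlSystem

/-! ### Filippov's theorem and the stability of trajectories and their costs. -/

namespace ControlSystem

variable {X : Type*} [NormedAddCommGroup X] [InnerProductSpace ℝ X] [FiniteDimensional ℝ X] {m : ℕ}
  {S : ControlSystem X m}

/-- Filippov's theorem: a trajectory can be followed, in position and in velocity, from every
initial point near its own. -/
theorem IsUnconstrainedTraj.exists_near (hS : S.Standing) {x y : X} {T : ℝ} {p : ℝ → X}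
    (h : S.IsUnconstrainedTraj x y T p) {η : ℝ} (hη : 0 < η) :
    ∃ δ > 0, ∀ x', ‖x' - x‖ < δ → ∃ (q v : ℝ → X) (K : NNReal), q 0 = x' ∧ LipschitzWith K q ∧
      (∀ t ∈ Icc 0 T, ‖q t - p t‖ ≤ η) ∧
      ∀ᵐ t ∂volume.restrict (Icc 0 T), v t ∈ S.F (q t) ∧ HasDerivAt q (v t) t ∧
        ‖v t - deriv p t‖ ≤ η := by
  have : CompleteSpace X := FiniteDimensional.complete ℝ X
  have : ProperSpace X := FiniteDimensional.proper_real X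
  have hT := h.nonneg
  obtain ⟨R, hR⟩ := isCompact_Icc.exists_bound_of_continuousOn h.continuousOn
  obtain ⟨k, hk0, hk⟩ := hS.exists_norm_sub_le (isCompact_closedBall (0 : X) (R + 1))
  obtain ⟨M, hM0, hM⟩ := hS.F_bounded _ (isCompact_closedBall (0 : X) (R + 1))
  set B := Real.exp (2 * k * T) with hB
  have hB0 : 0 < B := Real.exp_pos _
  -- The geometric series of corrections sum to `2 * A` in position and `2 * (k * A)` in velocity;
  -- this radius makes both at most `η`, and `2 * A ≤ 1`.
  refine ⟨min 1 η / (2 * (1 + k) * B), by positivity, fun x' hx' => ?_⟩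
  set A := ‖x' - x‖ * B with hA
  have hA0 : 0 ≤ A := by positivity
  have hA1 : 2 * (1 + k) * A ≤ min 1 η := by
    rw [lt_div_iff₀ (by positivity)] at hx'
    rw [hA]
    nlinarith
  have hA2 : 2 * A ≤ min 1 η := by nlinarith
  have hA3 : 2 * (k * A) ≤ η := by nlinarith [min_le_right 1 η]
  have est := picard_estimate hS h hR hk0 hk hM0.le hM (x' := x') (hA2.trans (min_le_left _ _))
  set q := fun n => (S.picard T x' p n).1 with hq
  set v := fun n => (S.picard T x' p n).2 with hv
  have hclose : ∀ n t, ‖q n t - q 0 t‖ ≤ 1 := by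
    intro n t
    refine ((est n).1 n le_rfl t).trans ?_
    have h1 : (0 : ℝ) ≤ (1 / 2) ^ n := by positivity
    have h2 := hA2.trans (min_le_left _ _)
    have h3 : 0 ≤ A * (1 / 2) ^ n := by positivity
    change 2 * A * (1 - (1 / 2) ^ n) ≤ 1
    linarith
  have hq0 : ∀ t, ‖q 0 t‖ ≤ R := fun t => hR _ (clamp_mem hT t)
  have hball : ∀ n t, q n t ∈ Metric.closedBall (0 : X) (R + 1) := by
    intro n t
    rw [mem_closedBall_zero_iff]
    linarith [norm_le_norm_add_norm_sub' (q n t) (q 0 t), hclose n t, hq0 t]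
  have hvF : ∀ n t, v n t ∈ S.F (q n t) := picard_snd_mem hS T x' p
  have hvM : ∀ n t, ‖v n t‖ ≤ M := fun n t => hM _ (hball n t) _ (hvF n t)
  have hmeas : ∀ n, StronglyMeasurable (v n) := fun n =>
    (picard_measurable hS (M := ⟨M, hM0.le⟩) x' hT h.continuousOn n fun j _ => hvM j).2
  have hqd : ∀ t n, Dist.dist (q n t) (q (n + 1) t) ≤ 2 * A / 2 / 2 ^ n := by
    intro t n
    rw [dist_comm, dist_eq_norm]
    refine ((est n).2 t).trans ?_
    have : Real.exp (2 * k * max 0 (min T t)) ≤ B :=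
      Real.exp_le_exp.2 (mul_le_mul_of_nonneg_left (clamp_mem hT t).2 (by positivity))
    calc ‖x' - x‖ * (1 / 2) ^ n * Real.exp (2 * k * max 0 (min T t))
        ≤ ‖x' - x‖ * (1 / 2) ^ n * B := by gcongr
      _ = 2 * A / 2 / 2 ^ n := by rw [hA, one_div, inv_pow]; field_simp
  have hvd : ∀ t n, Dist.dist (v n t) (v (n + 1) t) ≤ 2 * (k * A) / 2 / 2 ^ n := by
    intro t n
    obtain ⟨w, hw, hle⟩ := hk _ (hball n t) _ (hball (n + 1) t) _ (hvF n t)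
    have e1 := hS.norm_sub_nearest_le (q (n + 1) t, v n t) hw
    have e2 : S.nearest (q (n + 1) t, v n t) = v (n + 1) t := rfl
    rw [e2] at e1
    rw [dist_eq_norm]
    refine (e1.trans hle).trans ?_
    rw [← dist_eq_norm]
    calc k * Dist.dist (q n t) (q (n + 1) t) ≤ k * (2 * A / 2 / 2 ^ n) :=
          mul_le_mul_of_nonneg_left (hqd t n) hk0.le
      _ = 2 * (k * A) / 2 / 2 ^ n := by ring
  choose Q hQ using fun t => cauchySeq_tendsto_of_complete (cauchySeq_of_le_geometric_two (hqd t))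
  choose V hV using fun t => cauchySeq_tendsto_of_complete (cauchySeq_of_le_geometric_two (hvd t))
  have hVm : StronglyMeasurable V :=
    stronglyMeasurable_of_tendsto Filter.atTop hmeas (tendsto_pi_nhds.2 hV)
  have hVM : ∀ t, ‖V t‖ ≤ M := fun t =>
    le_of_tendsto (hV t).norm (Filter.Eventually.of_forall fun n => hvM n t)
  have hVF : ∀ t, V t ∈ S.F (Q t) := fun t =>
    hS.F_closed_graph.mem_of_tendsto ((hQ t).prodMk_nhds (hV t))
      (Filter.Eventually.of_forall fun n => hvF n t)
  have hQV : ∀ t ∈ Icc 0 T, Q t = x' + ∫ s in (0 : ℝ)..t, V s := by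
    intro t ht
    have h1 : Filter.Tendsto (fun n => x' + ∫ s in (0 : ℝ)..t, v n s) Filter.atTop
        (nhds (x' + ∫ s in (0 : ℝ)..t, V s)) := by
      refine tendsto_const_nhds.add
        (intervalIntegral.tendsto_integral_filter_of_dominated_convergence (fun _ => M)
        (Filter.Eventually.of_forall fun n => (hmeas n).aestronglyMeasurable)
        (Filter.Eventually.of_forall fun n => Filter.Eventually.of_forall fun s _ => hvM n s)
        intervalIntegrable_const (Filter.Eventually.of_forall fun s _ => hV s))
    have h2 := (Filter.tendsto_add_atTop_iff_nat 1).2 (hQ t)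
    refine tendsto_nhds_unique h2 (h1.congr fun n => ?_)
    have : q (n + 1) t = x' + ∫ s in (0 : ℝ)..max 0 (min T t), v n s := rfl
    rw [this, clamp_eq ht]
  -- The limit `Q` is constant beyond `[0,T]`; the integral agrees with it on `[0,T]` and has
  -- derivative `V` almost everywhere.
  refine ⟨fun t => x' + ∫ s in (0 : ℝ)..t, V s, V, ⟨M, hM0.le⟩, by simp,
    lipschitzWith_integral_of_norm_le (M := ⟨M, hM0.le⟩) hVm hVM x', fun t ht => ?_, ?_⟩
  · beta_reduce
    rw [← hQV t ht]
    have := dist_le_of_le_geometric_two_of_tendsto₀ (hqd t) (hQ t)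
    rw [dist_comm, dist_eq_norm] at this
    have e : q 0 t = p t := by simp only [hq, picard]; rw [clamp_eq ht]
    rw [e] at this
    exact this.trans (hA2.trans (min_le_right _ _))
  · have hd := (intervalIntegrable_of_norm_le hVm hVM 0 T).ae_hasDerivAt_integral
    rw [uIcc_of_le hT] at hd
    filter_upwards [h.ae_hasDerivAt, ae_restrict_of_ae hd, ae_restrict_mem measurableSet_Icc]
      with t ht hdt htm
    refine ⟨hQV t htm ▸ hVF t, (hdt htm 0 ⟨le_rfl, hT⟩).const_add x', ?_⟩
    have := dist_le_of_le_geometric_two_of_tendsto₀ (hvd t) (hV t)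
    rw [dist_comm, dist_eq_norm] at this
    have e : v 0 t = deriv p t := by
      simp only [hv, picard]
      rw [clamp_eq htm]
      exact hS.nearest_eq_self ht.1
    rw [e] at this
    exact this.trans hA3

/-- A trajectory in the free space can be followed from all nearby points, ending near its end
point and at nearly the same cost. -/
theorem IsTraj.eventually_exists_near (hS : S.Standing) {x y : X} {T : ℝ} {p : ℝ → X}
    (h : S.IsTraj x y T p) (hfree : ∀ t ∈ Icc 0 T, p t ∈ S.free) {ε : ℝ} (hε : 0 < ε) :
    ∀ᶠ x' in nhds x, ∃ (y' : X) (q : ℝ → X), S.IsTraj x' y' T q ∧ ‖y' - y‖ < ε ∧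
      S.cost T q ≤ S.cost T p + ENNReal.ofReal ε := by
  have : ProperSpace X := FiniteDimensional.proper_real X
  have hT := h.nonneg
  obtain ⟨R, hR⟩ := isCompact_Icc.exists_bound_of_continuousOn h.continuousOn
  obtain ⟨M, hM0, hM⟩ := h.exists_bound hS
  obtain ⟨η₁, hη₁, hsub⟩ := (isCompact_Icc.image_of_continuousOn h.continuousOn)
    |>.exists_thickening_subset_open hS.obst_closed.isOpen_compl
      (by rintro _ ⟨t, ht, rfl⟩; exact hfree t ht)
  have huc := ((isCompact_closedBall (0 : X) (R + 1)).prod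
    (isCompact_closedBall (0 : X) (M + 1))).uniformContinuousOn_of_continuous
      hS.ψ_continuous.continuousOn
  -- Integrated over `[0,T]`, this tolerance costs at most `ε`; `T + 1` covers `T = 0`.
  obtain ⟨η₂, hη₂, hψ⟩ := Metric.uniformContinuousOn_iff.1 huc (ε / (T + 1)) (by positivity)
  set η := min (min 1 (ε / 2)) (min (η₁ / 2) (η₂ / 2)) with hη
  have hη0 : 0 < η := by positivity
  have l1 : η ≤ 1 := (min_le_left _ _).trans (min_le_left _ _)
  have l2 : η ≤ ε / 2 := (min_le_left _ _).trans (min_le_right _ _)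
  have l3 : η ≤ η₁ / 2 := (min_le_right _ _).trans (min_le_left _ _)
  have l4 : η ≤ η₂ / 2 := (min_le_right _ _).trans (min_le_right _ _)
  obtain ⟨δ, hδ, hnear⟩ := h.exists_near hS hη0
  filter_upwards [Metric.ball_mem_nhds x hδ] with x' hx'
  rw [Metric.mem_ball, dist_eq_norm] at hx'
  obtain ⟨q, v, K, hq0, hqL, hqp, hae⟩ := hnear x' hx'
  refine ⟨q T, q, ?_, ?_, ?_⟩
  · rw [← hq0]
    refine isTraj_of_lipschitzOnWith hT (hqL.lipschitzOnWith (s := Icc 0 T)) ?_ fun t ht => ?_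
    · filter_upwards [hae] with t ht using ⟨v t, ht.1, ht.2.1⟩
    · refine subset_closure (hsub ?_)
      rw [Metric.mem_thickening_iff]
      refine ⟨p t, mem_image_of_mem p ht, ?_⟩
      rw [dist_eq_norm]
      linarith [hqp t ht]
  · have := hqp T ⟨hT, le_rfl⟩
    rw [h.finish] at this
    linarith
  · have hle : ∀ᵐ t ∂volume.restrict (Icc 0 T), ENNReal.ofReal (S.ψ (q t) (deriv q t)) ≤
        ENNReal.ofReal (S.ψ (p t) (deriv p t)) + ENNReal.ofReal (ε / (T + 1)) := by
      filter_upwards [hae, h.ae_hasDerivAt, ae_restrict_mem measurableSet_Icc]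
        with t ⟨h1, h2, h3⟩ h4 ht
      rw [h2.deriv, ← ENNReal.ofReal_add (hS.ψ_pos _ _).le (by positivity)]
      refine ENNReal.ofReal_le_ofReal ?_
      have b1 := hqp t ht
      have b2 := hR t ht
      have b3 := hM t ht _ h4.1
      have m1 : (q t, v t) ∈ Metric.closedBall (0 : X) (R + 1) ×ˢ
          Metric.closedBall (0 : X) (M + 1) := by
        refine ⟨?_, ?_⟩ <;> rw [mem_closedBall_zero_iff]
        · linarith [norm_le_norm_add_norm_sub' (q t) (p t)]
        · linarith [norm_le_norm_add_norm_sub' (v t) (deriv p t)]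
      have m2 : (p t, deriv p t) ∈ Metric.closedBall (0 : X) (R + 1) ×ˢ
          Metric.closedBall (0 : X) (M + 1) := by
        refine ⟨?_, ?_⟩ <;> rw [mem_closedBall_zero_iff]
        · exact b2.trans (by linarith)
        · exact b3.trans (by linarith)
      have := hψ _ m1 _ m2 (by
        rw [Prod.dist_eq, dist_eq_norm, dist_eq_norm]
        exact max_lt (by linarith) (by linarith))
      rw [Real.dist_eq] at this
      linarith [le_abs_self (S.ψ (q t) (v t) - S.ψ (p t) (deriv p t))]
    refine (lintegral_mono_ae hle).trans ?_
    rw [lintegral_add_right _ measurable_const]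
    refine add_le_add le_rfl ?_
    rw [setLIntegral_const, Real.volume_Icc, ← ENNReal.ofReal_mul (by positivity)]
    refine ENNReal.ofReal_le_ofReal ?_
    rw [sub_zero, div_mul_eq_mul_div, div_le_iff₀ (by positivity)]
    nlinarith

end ControlSystem

/-! ### Parametrization by cost, and compactness of the resulting curves. -/

namespace ControlSystem

variable {X : Type*} [NormedAddCommGroup X] [InnerProductSpace ℝ X] {m : ℕ}
  {S : ControlSystem X m}

theorem Standing.zero_mem_costVel (hS : S.Standing) (x : X) : (0 : X) ∈ S.costVel x := by
  obtain ⟨v, hv⟩ := hS.F_nonempty x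
  exact ⟨v, hv, 0, ⟨le_rfl, zero_le_one⟩, by simp⟩

theorem inv_smul_mem_costVel {x v : X} (hv : v ∈ S.F x) : (S.ψ x v)⁻¹ • v ∈ S.costVel x :=
  ⟨v, hv, 1, ⟨zero_le_one, le_rfl⟩, by rw [one_div]⟩

/-- Curves on `[0,ρ]` whose mean velocities obey the convexified inclusion in `costVel`. -/
structure IsRelaxed (S : ControlSystem X m) (ρ : ℝ) (q : ℝ → X) : Prop where
  bounded : ∃ R, ∀ s ∈ Icc 0 ρ, ‖q s‖ ≤ R
  -- No derivative appears, so the condition can be exploited under pointwise limits.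
  slope_mem : ∀ s ∈ Icc 0 ρ, ∀ s' ∈ Icc 0 ρ, s < s' → ∀ C : Set X, Convex ℝ C → IsClosed C →
    (∀ r ∈ Icc s s', S.costVel (q r) ⊆ C) → (s' - s)⁻¹ • (q s' - q s) ∈ C

theorem IsTraj.integrableOn_ψ (hS : S.Standing) {x y : X} {T : ℝ} {p : ℝ → X} [CompleteSpace X]
    (h : S.IsTraj x y T p) (hfin : S.cost T p ≠ ∞) :
    IntegrableOn (fun t => S.ψ (p t) (deriv p t)) (Icc 0 T) := by
  have hm : AEStronglyMeasurable (fun t => S.ψ (p t) (deriv p t)) (volume.restrict (Icc 0 T)) :=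
    hS.ψ_continuous.comp_aestronglyMeasurable
      ((h.continuousOn.aestronglyMeasurable measurableSet_Icc).prodMk
        (stronglyMeasurable_deriv p).aestronglyMeasurable)
  refine (lintegral_ofReal_ne_top_iff_integrable hm ?_).1 hfin
  exact Filter.Eventually.of_forall fun t => (hS.ψ_pos _ _).le

/-- Parametrizing a trajectory by cost, and waiting at its end, gives a relaxed curve. -/
theorem IsTraj.exists_isRelaxed [CompleteSpace X] (hS : S.Standing) {x y : X} {T : ℝ} {p : ℝ → X}
    (h : S.IsTraj x y T p) {ρ : ℝ} (hρ : S.cost T p < ENNReal.ofReal ρ) :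
    ∃ q, q 0 = x ∧ q ρ = y ∧ (∀ s ∈ Icc 0 ρ, q s ∈ closure S.free) ∧ S.IsRelaxed ρ q := by
  have hT := h.nonneg
  set g : ℝ → ℝ := fun t => S.ψ (p t) (deriv p t) with hg
  have hgpos : ∀ t, 0 < g t := fun t => hS.ψ_pos _ _
  have hgi : IntegrableOn g (Icc 0 T) := h.integrableOn_ψ hS hρ.ne_top
  have hii : ∀ a ∈ Icc 0 T, ∀ b ∈ Icc 0 T, IntervalIntegrable g volume a b := fun a ha b hb =>
    (hgi.mono_set (OrdConnected.uIcc_subset inferInstance ha hb)).intervalIntegrable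
  have h0m : (0 : ℝ) ∈ Icc 0 T := ⟨le_rfl, hT⟩
  have hTm : T ∈ Icc 0 T := ⟨hT, le_rfl⟩
  set σ : ℝ → ℝ := fun t => ∫ r in (0 : ℝ)..t, g r with hσ
  have hσsub : ∀ a ∈ Icc 0 T, ∀ b ∈ Icc 0 T, ∫ r in a..b, g r = σ b - σ a := fun a ha b hb =>
    (intervalIntegral.integral_interval_sub_left (hii 0 h0m b hb) (hii 0 h0m a ha)).symm
  have hmono : StrictMonoOn σ (Icc 0 T) := by
    intro a ha b hb hab
    have := intervalIntegral.intervalIntegral_pos_of_pos_on (hii a ha b hb) (fun r _ => hgpos r) hab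
    rw [hσsub a ha b hb] at this
    linarith
  have hσ0 : σ 0 = 0 := by simp [hσ]
  set c := σ T with hc
  have hc0 : 0 ≤ c := by
    rw [← hσ0]; exact hmono.monotoneOn h0m hTm hT
  have hcρ : c < ρ := by
    have : S.cost T p = ENNReal.ofReal c := by
      rw [hc, hσ, cost]
      simp only
      rw [intervalIntegral.integral_of_le hT, ← integral_Icc_eq_integral_Ioc,
        ofReal_integral_eq_lintegral_ofReal hgi
          (Filter.Eventually.of_forall fun t => (hgpos t).le)]
    rw [this] at hρ
    exact (ENNReal.ofReal_lt_ofReal_iff_of_nonneg hc0).1 hρ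
  have hcont : ContinuousOn σ (Icc 0 T) := by
    have := intervalIntegral.continuousOn_primitive_interval (a := 0) (b := T) (f := g)
      (μ := volume) (by rwa [uIcc_of_le hT])
    rwa [uIcc_of_le hT] at this
  -- The minimum with the total cost `c` encodes waiting at the end point for parameters beyond `c`.
  have hex : ∀ s, ∃ t, 0 ≤ s → t ∈ Icc 0 T ∧ σ t = min s c := by
    intro s
    by_cases hs : 0 ≤ s
    · have : min s c ∈ Icc (σ 0) (σ T) := ⟨by rw [hσ0]; exact le_min hs hc0, min_le_right _ _⟩
      obtain ⟨t, ht, e⟩ := intermediate_value_Icc hT hcont this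
      exact ⟨t, fun _ => ⟨ht, e⟩⟩
    · exact ⟨0, fun h => absurd h hs⟩
  choose τ hτ using hex
  refine ⟨fun s => p (τ s), ?_, ?_, fun s hs => h.mem_closure _ (hτ s hs.1).1, ?_, ?_⟩
  · obtain ⟨h1, h2⟩ := hτ 0 le_rfl
    simp only
    rw [hmono.injOn h1 h0m (by rw [h2, min_eq_left hc0, hσ0]), h.start]
  · obtain ⟨h1, h2⟩ := hτ ρ (hc0.trans hcρ.le)
    simp only
    rw [hmono.injOn h1 hTm (by rw [h2, min_eq_right hcρ.le]), h.finish]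
  · obtain ⟨R, hR⟩ := isCompact_Icc.exists_bound_of_continuousOn h.continuousOn
    exact ⟨R, fun s hs => hR _ (hτ s hs.1).1⟩
  · intro s hs s' hs' hss C hC hC' hsub
    obtain ⟨ha, ea⟩ := hτ s hs.1
    obtain ⟨hb, eb⟩ := hτ s' hs'.1
    have hab : τ s ≤ τ s' := by
      rw [← hmono.le_iff_le ha hb, ea, eb]
      exact min_le_min_right _ hss.le
    have hI : Icc (τ s) (τ s') ⊆ Icc 0 T := Icc_subset_Icc ha.1 hb.2
    -- Such a time `r` equals `τ (max s (σ r))`; the maximum matters only while waiting, when `s`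
    -- exceeds `c`.
    have hpC : ∀ r ∈ Icc (τ s) (τ s'), S.costVel (p r) ⊆ C := by
      intro r hr
      have h1 : min s c ≤ σ r := ea ▸ hmono.monotoneOn ha (hI hr) hr.1
      have h2 : σ r ≤ min s' c := eb ▸ hmono.monotoneOn (hI hr) hb hr.2
      have hr' : max s (σ r) ∈ Icc s s' :=
        ⟨le_max_left _ _, max_le hss.le (h2.trans (min_le_left _ _))⟩
      obtain ⟨h3, h4⟩ := hτ (max s (σ r)) (hs.1.trans hr'.1)
      have h5 : min (max s (σ r)) c = σ r := by
        have := h2.trans (min_le_right _ _)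
        rcases le_total s c with h | h
        · rw [min_eq_left h] at h1
          rw [max_eq_right h1, min_eq_left this]
        · rw [min_eq_right h] at h1
          rw [max_eq_left (this.trans h), min_eq_right h]
          exact le_antisymm h1 this
      have := hsub _ hr'
      rwa [hmono.injOn h3 (hI hr) (h4.trans h5)] at this
    -- The weight is the running cost. While waiting, its integral falls short of `s' - s`, which is
    -- harmless because `0` is in `costVel`.
    refine AbsolutelyContinuousOnInterval.inv_smul_sub_mem hab
      (h.ac.mono (by rwa [uIcc_of_le hab, uIcc_of_le hT])) hC hC' (hii _ ha _ hb)
      (fun t => (hgpos t).le) ?_ (sub_pos.2 hss) (Or.inr ⟨?_, ?_⟩)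
    · filter_upwards [ae_restrict_of_ae_restrict_of_subset hI h.ae_hasDerivAt,
        ae_restrict_mem measurableSet_Icc] with r hr hr'
      refine ⟨(g r)⁻¹ • deriv p r, hpC r hr' (inv_smul_mem_costVel hr.1), ?_⟩
      rw [smul_inv_smul₀ (hgpos r).ne']
      exact hr.2
    · exact hpC _ ⟨le_rfl, hab⟩ (hS.zero_mem_costVel _)
    · rw [hσsub _ ha _ hb, ea, eb]
      rcases le_total s c with h1 | h1
      · rw [min_eq_left h1]
        linarith [min_le_left s' c]
      · rw [min_eq_right h1]
        linarith [min_le_right s' c]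

theorem norm_le_of_mem_costVel {γ c : ℝ}
    (hgr : ∀ x, ∀ v ∈ S.F x, ‖(S.ψ x v)⁻¹ • v‖ ≤ γ * ‖x‖ + c) {x w : X}
    (hw : w ∈ S.costVel x) : ‖w‖ ≤ γ * ‖x‖ + c := by
  obtain ⟨v, hv, θ, hθ, rfl⟩ := hw
  rw [div_eq_mul_inv, mul_smul, norm_smul, Real.norm_of_nonneg hθ.1]
  exact (mul_le_of_le_one_left (norm_nonneg _) hθ.2).trans (hgr x v hv)

theorem IsRelaxed.norm_slope_le {ρ : ℝ} {q : ℝ → X} (hq : S.IsRelaxed ρ q) {γ c : ℝ}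
    (hγ : 0 < γ) (hgr : ∀ x, ∀ v ∈ S.F x, ‖(S.ψ x v)⁻¹ • v‖ ≤ γ * ‖x‖ + c)
    {s s' R : ℝ} (hs : s ∈ Icc 0 ρ) (hs' : s' ∈ Icc 0 ρ) (hss : s < s')
    (hR : ∀ r ∈ Icc s s', ‖q r‖ ≤ R) : ‖(s' - s)⁻¹ • (q s' - q s)‖ ≤ γ * R + c := by
  have := hq.slope_mem s hs s' hs' hss (Metric.closedBall 0 (γ * R + c)) (convex_closedBall _ _)
    Metric.isClosed_closedBall fun r hr w hw => by
      rw [mem_closedBall_zero_iff]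
      refine (norm_le_of_mem_costVel hgr hw).trans ?_
      gcongr
      exact hR r hr
  rwa [mem_closedBall_zero_iff] at this

theorem IsRelaxed.norm_sub_le {ρ : ℝ} {q : ℝ → X} (hq : S.IsRelaxed ρ q) {γ c : ℝ}
    (hγ : 0 < γ) (hgr : ∀ x, ∀ v ∈ S.F x, ‖(S.ψ x v)⁻¹ • v‖ ≤ γ * ‖x‖ + c)
    {R : ℝ} (hR : ∀ r ∈ Icc 0 ρ, ‖q r‖ ≤ R) {s s' : ℝ} (hs : s ∈ Icc 0 ρ) (hs' : s' ∈ Icc 0 ρ)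
    (hss : s ≤ s') : ‖q s' - q s‖ ≤ (γ * R + c) * (s' - s) := by
  rcases hss.eq_or_lt with rfl | hss
  · simp
  have := hq.norm_slope_le hγ hgr hs hs' hss fun r hr => hR r (Icc_subset_Icc hs.1 hs'.2 hr)
  have h0 : 0 < s' - s := sub_pos.2 hss
  rw [norm_smul, norm_inv, Real.norm_of_nonneg h0.le, inv_mul_le_iff₀ h0] at this
  linarith

/-- A curve with a Lipschitz estimate for ordered pairs of parameters is Lipschitz. -/
theorem lipschitzOnWith_of_norm_sub_le {X : Type*} [SeminormedAddCommGroup X] {q : ℝ → X}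
    {s : Set ℝ} {L : NNReal} (h : ∀ a ∈ s, ∀ b ∈ s, a ≤ b → ‖q b - q a‖ ≤ L * (b - a)) :
    LipschitzOnWith L q s := by
  refine LipschitzOnWith.of_dist_le_mul fun a ha b hb => ?_
  rcases le_total a b with hab | hab
  · rw [dist_comm, dist_eq_norm, dist_comm, Real.dist_eq, abs_of_nonneg (by linarith)]
    exact h a ha b hb hab
  · rw [dist_eq_norm, Real.dist_eq, abs_of_nonneg (by linarith)]
    exact h b hb a ha hab

theorem IsRelaxed.continuousOn {ρ : ℝ} {q : ℝ → X} (hS : S.Standing) (hq : S.IsRelaxed ρ q) :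
    ContinuousOn q (Icc 0 ρ) := by
  obtain ⟨γ, hγ, c, -, hgr⟩ := hS.cost_growth
  obtain ⟨R, hR⟩ := hq.bounded
  refine (lipschitzOnWith_of_norm_sub_le (L := Real.toNNReal (γ * R + c))
    fun a ha b hb hab => ?_).continuousOn
  refine (hq.norm_sub_le hγ hgr hR ha hb hab).trans ?_
  exact mul_le_mul_of_nonneg_right (Real.le_coe_toNNReal _) (sub_nonneg.2 hab)

/-- The a priori bound for relaxed curves. -/
theorem IsRelaxed.norm_le {ρ : ℝ} {q : ℝ → X} (hS : S.Standing) (hq : S.IsRelaxed ρ q) {γ c : ℝ}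
    (hγ : 0 < γ) (hc : 0 < c) (hgr : ∀ x, ∀ v ∈ S.F x, ‖(S.ψ x v)⁻¹ • v‖ ≤ γ * ‖x‖ + c)
    {R : ℝ} (hR : ‖q 0‖ ≤ R) {s : ℝ} (hs : s ∈ Icc 0 ρ) : ‖q s‖ ≤ gronwallBound R γ c ρ := by
  have hcont := hq.continuousOn hS
  -- Grönwall's inequality for the right difference quotients of the norm: the bound depends on the
  -- curve only through its initial point, unlike the one in `IsRelaxed.bounded`.
  have key : ∀ s ∈ Icc 0 ρ, ‖q s‖ ≤ gronwallBound R γ c (s - 0) := by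
    refine le_gronwallBound_of_liminf_deriv_right_le (f := fun s => ‖q s‖)
      (f' := fun s => γ * ‖q s‖ + c) hcont.norm ?_ hR (fun _ _ => le_rfl)
    intro s hs r hr
    have hs1 : s ∈ Icc 0 ρ := Ico_subset_Icc_self hs
    obtain ⟨η, hη, hηr⟩ : ∃ η > 0, γ * (‖q s‖ + η) + c < r := by
      refine ⟨(r - (γ * ‖q s‖ + c)) / (2 * γ), div_pos (by linarith) (by positivity), ?_⟩
      have : γ * ((r - (γ * ‖q s‖ + c)) / (2 * γ)) = (r - (γ * ‖q s‖ + c)) / 2 := by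
        field_simp
      rw [mul_add, this]
      linarith
    have h1 : ∀ᶠ z in nhdsWithin s (Icc 0 ρ), ‖q z‖ < ‖q s‖ + η :=
      (hcont.norm s hs1).eventually (gt_mem_nhds (by linarith))
    obtain ⟨δ, hδ, hball⟩ := Metric.mem_nhdsWithin_iff.1 h1
    refine Filter.Eventually.frequently ?_
    have h2 : Ioo s (min ρ (s + δ)) ∈ nhdsWithin s (Ioi s) :=
      Ioo_mem_nhdsGT (lt_min hs.2 (by linarith))
    filter_upwards [h2] with z hz
    have hz2 := hz.2
    rw [lt_min_iff] at hz2
    have hzm : z ∈ Icc 0 ρ := ⟨hs.1.trans hz.1.le, hz2.1.le⟩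
    have := hq.norm_slope_le hγ hgr hs1 hzm hz.1 (R := ‖q s‖ + η) fun u hu =>
      (hball ⟨by
        rw [Metric.mem_ball, Real.dist_eq, abs_of_nonneg (by linarith [hu.1])]
        linarith [hu.2], hs.1.trans hu.1, hu.2.trans hzm.2⟩ : ‖q u‖ < ‖q s‖ + η).le
    have h0 : 0 < z - s := sub_pos.2 hz.1
    rw [norm_smul, norm_inv, Real.norm_of_nonneg h0.le] at this
    refine lt_of_le_of_lt ?_ (this.trans_lt hηr)
    exact mul_le_mul_of_nonneg_left (norm_sub_norm_le _ _) (by positivity)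
  refine (key s hs).trans (gronwallBound_mono ((norm_nonneg _).trans hR) hc.le hγ.le ?_)
  linarith [hs.2]

theorem Standing.continuous_inv_smul (hS : S.Standing) :
    Continuous fun p : X × X => (S.ψ p.1 p.2)⁻¹ • p.2 :=
  (hS.ψ_continuous.inv₀ fun _ => (hS.ψ_pos _ _).ne').smul continuous_snd

variable [FiniteDimensional ℝ X]

theorem Standing.isCompact_F (hS : S.Standing) (x : X) : IsCompact (S.F x) := by
  have : ProperSpace X := FiniteDimensional.proper_real X
  obtain ⟨M, -, hM⟩ := hS.F_bounded {x} isCompact_singleton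
  refine (isCompact_closedBall (0 : X) M).of_isClosed_subset (hS.isClosed_F x) fun v hv => ?_
  rw [mem_closedBall_zero_iff]
  exact hM x rfl v hv

theorem Standing.isClosed_costVel (hS : S.Standing) (x : X) : IsClosed (S.costVel x) := by
  have hc : Continuous fun a : ℝ × X => a.1 • ((S.ψ x a.2)⁻¹ • a.2) :=
    continuous_fst.smul
      (hS.continuous_inv_smul.comp (by fun_prop : Continuous fun a : ℝ × X => (x, a.2)))
  have := ((isCompact_Icc (a := (0 : ℝ)) (b := 1)).prod (hS.isCompact_F x)).image hc
  convert! this.isClosed using 1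
  ext w
  simp only [costVel, mem_image, Prod.exists, mem_prod]
  constructor
  · rintro ⟨v, hv, θ, hθ, rfl⟩
    exact ⟨θ, v, ⟨hθ, hv⟩, by rw [smul_smul, div_eq_mul_inv]⟩
  · rintro ⟨θ, v, ⟨hθ, hv⟩, rfl⟩
    exact ⟨v, hv, θ, hθ, by rw [smul_smul, div_eq_mul_inv]⟩

/-- The multifunction `costVel` is upper semicontinuous. -/
theorem Standing.eventually_costVel_subset (hS : S.Standing) (x : X) {ε : ℝ} (hε : 0 < ε) :
    ∀ᶠ z in nhds x, S.costVel z ⊆ Metric.cthickening ε (S.costVel x) := by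
  have : ProperSpace X := FiniteDimensional.proper_real X
  have hK := isCompact_closedBall x (1 : ℝ)
  have hx : x ∈ Metric.closedBall x 1 := Metric.mem_closedBall_self zero_le_one
  obtain ⟨M, hM, hMb⟩ := hS.F_bounded _ hK
  obtain ⟨k, hk, hkb⟩ := hS.exists_norm_sub_le hK
  have huc := (hK.prod (isCompact_closedBall (0 : X) M)).uniformContinuousOn_of_continuous
    hS.continuous_inv_smul.continuousOn
  obtain ⟨η, hη, hψ⟩ := Metric.uniformContinuousOn_iff.1 huc ε hε
  have hδ : 0 < min 1 (η / (k + 1)) := by positivity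
  filter_upwards [Metric.ball_mem_nhds x hδ] with z hz
  rw [Metric.mem_ball, lt_min_iff, lt_div_iff₀ (by positivity)] at hz
  have hz1 : z ∈ Metric.closedBall x 1 := hz.1.le
  rintro _ ⟨v, hv, θ, hθ, rfl⟩
  obtain ⟨w, hw, hvw⟩ := hkb z hz1 x hx v hv
  rw [← dist_eq_norm, ← dist_eq_norm] at hvw
  have hd := hψ (z, v) ⟨hz1, mem_closedBall_zero_iff.2 (hMb z hz1 v hv)⟩ (x, w)
    ⟨hx, mem_closedBall_zero_iff.2 (hMb x hx w hw)⟩ (by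
      rw [Prod.dist_eq]
      have := dist_nonneg (x := z) (y := x)
      exact max_lt (by simp only; nlinarith) (by simp only; nlinarith))
  refine Metric.mem_cthickening_of_dist_le _ ((θ / S.ψ x w) • w) _ _ ⟨w, hw, θ, hθ, rfl⟩ ?_
  simp only [div_eq_mul_inv, mul_smul]
  rw [dist_smul₀, Real.norm_of_nonneg hθ.1]
  exact (mul_le_of_le_one_left dist_nonneg hθ.2).trans hd.le

/-- Limits of relaxed curves: from a point that is approximated by points of clearance less than
`ρ`, a solution of the inclusion in `costVel` reaches the obstacle within cost `ρ`. -/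
theorem Standing.exists_curve_of_mem_closure (hS : S.Standing) {ρ : ℝ} (hρ : 0 < ρ) {x : X}
    (hx : x ∈ closure {x | S.clr x < ENNReal.ofReal ρ}) :
    ∃ (q : ℝ → X) (L : NNReal), q 0 = x ∧ q ρ ∈ S.obst ∧ LipschitzOnWith L q (Icc 0 ρ) ∧
      (∀ s ∈ Icc 0 ρ, q s ∈ closure S.free) ∧
      ∀ s ∈ Ioo 0 ρ, ∀ w, HasDerivAt q w s → w ∈ S.costVel (q s) := by
  have : CompleteSpace X := FiniteDimensional.complete ℝ X
  have : ProperSpace X := FiniteDimensional.proper_real X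
  obtain ⟨γ, hγ, c, hc, hgr⟩ := hS.cost_growth
  have hex : ∀ x', ∃ q : ℝ → X, S.clr x' < ENNReal.ofReal ρ → q 0 = x' ∧ q ρ ∈ S.obst ∧
      (∀ s ∈ Icc 0 ρ, q s ∈ closure S.free) ∧ S.IsRelaxed ρ q := by
    intro x'
    by_cases hx' : S.clr x' < ENNReal.ofReal ρ
    · simp only [clr, dist, iInf_lt_iff] at hx'
      obtain ⟨y, hy, T, p, hp, hlt⟩ := hx'
      obtain ⟨q, h1, h2, h3, h4⟩ := hp.exists_isRelaxed hS hlt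
      exact ⟨q, fun _ => ⟨h1, h2 ▸ hy, h3, h4⟩⟩
    · exact ⟨fun _ => 0, fun h => absurd h hx'⟩
  choose Q hQ using hex
  have hne := mem_closure_iff_nhdsWithin_neBot.1 hx
  -- Along an ultrafilter, bounded curves converge at all parameters at once, so no subsequence is
  -- extracted.
  set 𝒰 := Ultrafilter.of (nhdsWithin x {x | S.clr x < ENNReal.ofReal ρ}) with h𝒰
  have hle : (𝒰 : Filter X) ≤ nhdsWithin x {x | S.clr x < ENNReal.ofReal ρ} := Ultrafilter.of_le _
  have hlex : (𝒰 : Filter X) ≤ nhds x := hle.trans nhdsWithin_le_nhds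
  have hclr : ∀ᶠ x' in (𝒰 : Filter X), S.clr x' < ENNReal.ofReal ρ := hle self_mem_nhdsWithin
  set R := gronwallBound (‖x‖ + 1) γ c ρ with hR
  have hnorm : ∀ᶠ x' in (𝒰 : Filter X), ‖x'‖ ≤ ‖x‖ + 1 := hlex <| by
    filter_upwards [Metric.ball_mem_nhds x one_pos] with x' hx'
    rw [Metric.mem_ball, dist_eq_norm] at hx'
    linarith [norm_le_norm_add_norm_sub' x' x]
  have hbd : ∀ᶠ x' in (𝒰 : Filter X), ∀ s ∈ Icc 0 ρ, ‖Q x' s‖ ≤ R := by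
    filter_upwards [hclr, hnorm] with x' h1 h2 s hs
    obtain ⟨h3, -, -, h4⟩ := hQ x' h1
    exact h4.norm_le hS hγ hc hgr (by rwa [h3]) hs
  have hlim : ∀ s, ∃ a, s ∈ Icc 0 ρ → Filter.Tendsto (fun x' => Q x' s) 𝒰 (nhds a) := by
    intro s
    by_cases hs : s ∈ Icc 0 ρ
    · obtain ⟨a, -, ha⟩ := (isCompact_closedBall (0 : X) R).ultrafilter_le_nhds'
        (𝒰.map fun x' => Q x' s) (by
          change ∀ᶠ x' in (𝒰 : Filter X), Q x' s ∈ Metric.closedBall 0 R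
          filter_upwards [hbd] with x' h
          exact mem_closedBall_zero_iff.2 (h s hs))
      exact ⟨a, fun _ => ha⟩
    · exact ⟨0, fun h => absurd h hs⟩
  choose q hq using hlim
  have hR0 : 0 ≤ R := by
    obtain ⟨x', h⟩ := hbd.exists
    exact (norm_nonneg _).trans (h 0 ⟨le_rfl, hρ.le⟩)
  have hLip : ∀ᶠ x' in (𝒰 : Filter X), ∀ a ∈ Icc 0 ρ, ∀ b ∈ Icc 0 ρ, a ≤ b →
      ‖Q x' b - Q x' a‖ ≤ (γ * R + c) * (b - a) := by
    filter_upwards [hclr, hbd] with x' h1 h2 a ha b hb hab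
    exact (hQ x' h1).2.2.2.norm_sub_le hγ hgr h2 ha hb hab
  have h0m : (0 : ℝ) ∈ Icc 0 ρ := ⟨le_rfl, hρ.le⟩
  have hρm : ρ ∈ Icc 0 ρ := ⟨hρ.le, le_rfl⟩
  have hL0 : 0 < γ * R + c := by positivity
  refine ⟨q, ⟨γ * R + c, hL0.le⟩, ?_, ?_, lipschitzOnWith_of_norm_sub_le fun a ha b hb hab => ?_,
    fun s hs => ?_, fun s hs w hw => ?_⟩
  · refine tendsto_nhds_unique (hq 0 h0m) (Filter.Tendsto.congr' ?_ (hlex : Filter.Tendsto id _ _))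
    filter_upwards [hclr] with x' h using (hQ x' h).1.symm
  · refine hS.obst_closed.mem_of_tendsto (hq ρ hρm) ?_
    filter_upwards [hclr] with x' h using (hQ x' h).2.1
  · refine le_of_tendsto ((hq b hb).sub (hq a ha)).norm ?_
    filter_upwards [hLip] with x' h using h a ha b hb hab
  · refine isClosed_closure.mem_of_tendsto (hq s hs) ?_
    filter_upwards [hclr] with x' h using (hQ x' h).2.2.1 s hs
  -- It suffices to reach every closed thickening of `costVel (q s)`. It is convex because `costVel
  -- (q s)` is, and it contains the short slopes of the approximating curves by upper
  -- semicontinuity.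
  · rw [← (hS.isClosed_costVel (q s)).closure_eq, Metric.closure_eq_iInter_cthickening,
      mem_iInter₂]
    intro ε hε
    have hsm : s ∈ Icc 0 ρ := Ioo_subset_Icc_self hs
    obtain ⟨η, hη, hsub⟩ := Metric.eventually_nhds_iff.1 (hS.eventually_costVel_subset (q s) hε)
    have htend : Filter.Tendsto (fun s' => (s' - s)⁻¹ • (q s' - q s)) (nhdsWithin s (Ioi s))
        (nhds w) :=
      (hasDerivAt_iff_tendsto_slope.1 hw).mono_left (nhdsWithin_mono _ fun a ha => ne_of_gt ha)
    refine Metric.isClosed_cthickening.mem_of_tendsto htend ?_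
    have hI : Ioo s (min ρ (s + η / (2 * (γ * R + c)))) ∈ nhdsWithin s (Ioi s) :=
      Ioo_mem_nhdsGT (lt_min hs.2 (by linarith [show 0 < η / (2 * (γ * R + c)) by positivity]))
    filter_upwards [hI] with s' hs'
    have hs'2 := lt_min_iff.1 hs'.2
    have hs'm : s' ∈ Icc 0 ρ := ⟨hs.1.le.trans hs'.1.le, hs'2.1.le⟩
    have hsmall : (γ * R + c) * (s' - s) < η / 2 := by
      have h1 : s' - s < η / (2 * (γ * R + c)) := by linarith
      rw [lt_div_iff₀ (by positivity)] at h1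
      linarith
    refine Metric.isClosed_cthickening.mem_of_tendsto
      (((hq s' hs'm).sub (hq s hsm)).const_smul (s' - s)⁻¹) ?_
    have hnear : ∀ᶠ x' in (𝒰 : Filter X), Dist.dist (Q x' s) (q s) < η / 2 :=
      (hq s hsm).eventually (Metric.ball_mem_nhds (q s) (half_pos hη))
    filter_upwards [hclr, hLip, hnear] with x' h1 h2 h3
    refine (hQ x' h1).2.2.2.slope_mem s hsm s' hs'm hs'.1 _
      ((hS.costVel_convex (q s)).cthickening ε) Metric.isClosed_cthickening fun r hr => ?_
    refine hsub ((dist_triangle _ (Q x' s) _).trans_lt ?_)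
    have h4 := h2 s hsm r ⟨hs.1.le.trans hr.1, hr.2.trans hs'm.2⟩ hr.1
    have h5 : (γ * R + c) * (r - s) ≤ (γ * R + c) * (s' - s) :=
      mul_le_mul_of_nonneg_left (by linarith [hr.2]) hL0.le
    rw [dist_eq_norm]
    linarith

end ControlSystem

/-! ### From solutions of the cost inclusion back to trajectories; lower semicontinuity of the
clearance. -/

/-- A monotone function that takes the same value at two points has derivative zero between. -/
theorem MonotoneOn.deriv_eq_zero_of_eq {f : ℝ → ℝ} {a b s c : ℝ} (hf : MonotoneOn f (Icc a b))
    (hab : a < b) (h : f a = f b) (hs : s ∈ Icc a b) (hd : HasDerivAt f c s) : c = 0 := by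
  have hconst : ∀ r ∈ Icc a b, f r = f a := fun r hr =>
    le_antisymm (h ▸ hf hr ⟨hab.le, le_rfl⟩ hr.2) (hf ⟨le_rfl, hab.le⟩ hr hr.1)
  refine (uniqueDiffOn_Icc hab s hs).eq_deriv _ (hd.hasDerivWithinAt (s := Icc a b)) ?_
  exact (hasDerivWithinAt_const s (Icc a b) (f a)).congr hconst (hconst s hs)

/-- A Lipschitz function maps null sets to null sets. -/
theorem LipschitzWith.volume_image_eq_zero {f : ℝ → ℝ} {K : NNReal} (hf : LipschitzWith K f)
    {s : Set ℝ} (hs : volume s = 0) : volume (f '' s) = 0 := by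
  have := hf.hausdorffMeasure_image_le zero_le_one s
  rw [hausdorffMeasure_real, hs, mul_zero] at this
  exact le_antisymm this zero_le

/-- The set of critical values is null. -/
theorem volume_image_eq_zero_of_hasDerivAt_zero {f : ℝ → ℝ} {s : Set ℝ}
    (hs : ∀ t ∈ s, HasDerivAt f 0 t) : volume (f '' s) = 0 := by
  refine addHaar_image_eq_zero_of_det_fderivWithin_eq_zero volume
    (f' := fun _ => ContinuousLinearMap.toSpanSingleton ℝ (0 : ℝ))
    (fun t ht => (hs t ht).hasFDerivAt.hasFDerivWithinAt) fun t _ => ?_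
  simp [ContinuousLinearMap.det]

namespace ControlSystem

variable {X : Type*} [NormedAddCommGroup X] [InnerProductSpace ℝ X] {m : ℕ}
  {S : ControlSystem X m}

/-- The triples `(x, w, r)` such that `w = r • v` for an admissible velocity `v` at `x` that costs
at most one per `r` units of time. -/
def rateSet (S : ControlSystem X m) : Set ((X × X) × ℝ) :=
  {a | 0 ≤ a.2 ∧ ∃ v ∈ S.F a.1.1, a.1.2 = a.2 • v ∧ a.2 * S.ψ a.1.1 v ≤ 1}

/-- The least time per unit of cost needed to realize the velocity `w ∈ costVel x`. -/
noncomputable def rate (S : ControlSystem X m) (a : X × X) : ℝ := sInf {r | (a, r) ∈ S.rateSet}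

theorem rate_nonneg (S : ControlSystem X m) (a : X × X) : 0 ≤ S.rate a :=
  Real.sInf_nonneg fun _ hr => hr.1

theorem Standing.exists_mem_rateSet (hS : S.Standing) {x w : X} (hw : w ∈ S.costVel x) :
    ∃ r, ((x, w), r) ∈ S.rateSet := by
  obtain ⟨v, hv, θ, hθ, rfl⟩ := hw
  have h := hS.ψ_pos x v
  exact ⟨θ / S.ψ x v, div_nonneg hθ.1 h.le, v, hv, rfl, by
    simp only; rw [div_mul_cancel₀ _ h.ne']; exact hθ.2⟩

variable [FiniteDimensional ℝ X]

/-- Along a convergent sequence the velocities are bounded, so a subsequence converges, and the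
defining conditions are closed. -/
theorem Standing.isClosed_rateSet (hS : S.Standing) : IsClosed S.rateSet := by
  have : ProperSpace X := FiniteDimensional.proper_real X
  refine IsSeqClosed.isClosed fun u a hu hlim => ?_
  choose h0 v hv hw hψ using hu
  have h1 : Filter.Tendsto (fun n => (u n).1.1) Filter.atTop (nhds a.1.1) :=
    ((continuous_fst.comp continuous_fst).tendsto a).comp hlim
  have h2 : Filter.Tendsto (fun n => (u n).1.2) Filter.atTop (nhds a.1.2) :=
    ((continuous_snd.comp continuous_fst).tendsto a).comp hlim
  have h3 : Filter.Tendsto (fun n => (u n).2) Filter.atTop (nhds a.2) :=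
    (continuous_snd.tendsto a).comp hlim
  obtain ⟨M, -, hM⟩ := hS.F_bounded _ h1.isCompact_insert_range
  obtain ⟨w, -, φ, hφ, hw'⟩ := (isCompact_closedBall (0 : X) M).tendsto_subseq (x := v) fun n =>
    mem_closedBall_zero_iff.2 (hM _ (mem_insert_of_mem _ (mem_range_self n)) _ (hv n))
  have ht := hφ.tendsto_atTop
  refine ⟨ge_of_tendsto' h3 h0, w, ?_, ?_, ?_⟩
  · exact hS.F_closed_graph.mem_of_tendsto ((h1.comp ht).prodMk_nhds hw')
      (Filter.Eventually.of_forall fun n => hv (φ n))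
  · refine tendsto_nhds_unique (h2.comp ht) (((h3.comp ht).smul hw').congr fun n => ?_)
    exact (hw (φ n)).symm
  · exact le_of_tendsto' ((h3.comp ht).mul
      ((hS.ψ_continuous.tendsto (a.1.1, w)).comp ((h1.comp ht).prodMk_nhds hw')))
      fun n => hψ (φ n)

theorem Standing.rate_mem (hS : S.Standing) {a : X × X} {r : ℝ} (hr : (a, r) ∈ S.rateSet) :
    (a, S.rate a) ∈ S.rateSet :=
  IsClosed.csInf_mem (s := {r | (a, r) ∈ S.rateSet})
    (hS.isClosed_rateSet.preimage (Continuous.prodMk_right a)) ⟨r, hr⟩ ⟨0, fun _ h => h.1⟩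

/-- Rates are nonnegative, so this is a projection along the compact interval `[0,c]`. -/
theorem Standing.isClosed_exists_rate_le (hS : S.Standing) (c : ℝ) :
    IsClosed {a : X × X | ∃ r ≤ c, (a, r) ∈ S.rateSet} := by
  have h1 : IsClosed {b : (X × X) × Icc (0 : ℝ) c | (b.1, (b.2 : ℝ)) ∈ S.rateSet} :=
    hS.isClosed_rateSet.preimage (by fun_prop)
  convert! isClosedMap_fst_of_compactSpace _ h1 using 1
  ext a
  constructor
  · rintro ⟨r, hrc, hr⟩
    exact ⟨(a, ⟨r, hr.1, hrc⟩), hr, rfl⟩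
  · rintro ⟨⟨_, r, hrc⟩, hr, rfl⟩
    exact ⟨r, hrc.2, hr⟩

theorem Standing.measurable_rate [MeasurableSpace X] [BorelSpace X] (hS : S.Standing) :
    Measurable S.rate := by
  have : ProperSpace X := FiniteDimensional.proper_real X
  have hm : ∀ c, MeasurableSet {a : X × X | ∃ r ≤ c, (a, r) ∈ S.rateSet} := fun c =>
    (hS.isClosed_exists_rate_le c).measurableSet
  refine measurable_of_Iic fun c => ?_
  rcases lt_or_ge c 0 with hc | hc
  · convert! MeasurableSet.empty
    ext a
    simpa using hc.trans_le (S.rate_nonneg a)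
  -- The second set collects the pairs without any rate, for which the infimum of the empty set is
  -- `0`.
  · have : S.rate ⁻¹' Iic c = {a : X × X | ∃ r ≤ c, (a, r) ∈ S.rateSet} ∪
        (⋃ n : ℕ, {a : X × X | ∃ r ≤ (n : ℝ), (a, r) ∈ S.rateSet})ᶜ := by
      ext a
      simp only [mem_preimage, mem_Iic, mem_union, mem_compl_iff, mem_iUnion]
      constructor
      · intro h
        by_cases hn : ∃ n : ℕ, a ∈ {a : X × X | ∃ r ≤ (n : ℝ), (a, r) ∈ S.rateSet}
        · obtain ⟨n, r, -, hr⟩ := hn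
          exact Or.inl ⟨_, h, hS.rate_mem hr⟩
        · exact Or.inr hn
      · rintro (⟨r, hrc, hr⟩ | hn)
        · exact (csInf_le (⟨0, fun _ h => h.1⟩ : BddBelow {r | (a, r) ∈ S.rateSet}) hr).trans hrc
        · have : {r | (a, r) ∈ S.rateSet} = ∅ := by
            ext r
            simp only [mem_empty_iff_false, iff_false]
            intro hr
            obtain ⟨n, hn'⟩ := exists_nat_ge r
            exact hn ⟨n, r, hn', hr⟩
          change sInf {r | (a, r) ∈ S.rateSet} ≤ c
          rw [this, Real.sInf_empty]
          exact hc
    rw [this]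
    exact (hm c).union (MeasurableSet.iUnion fun n : ℕ => hm n).compl

/-- A solution on `[0,ρ]` of the inclusion in `costVel` can be traversed by a trajectory at cost at
most `ρ`. -/
theorem Standing.exists_traj_of_curve (hS : S.Standing) {ρ : ℝ} (hρ : 0 < ρ) {q : ℝ → X}
    {L : NNReal} (hq : LipschitzWith L q) (hmem : ∀ s ∈ Icc 0 ρ, q s ∈ closure S.free)
    (hd : ∀ s ∈ Ioo 0 ρ, ∀ w, HasDerivAt q w s → w ∈ S.costVel (q s)) :
    ∃ T p, S.IsTraj (q 0) (q ρ) T p ∧ S.cost T p ≤ ENNReal.ofReal ρ := by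
  have : CompleteSpace X := FiniteDimensional.complete ℝ X
  have : ProperSpace X := FiniteDimensional.proper_real X
  borelize X
  have h0m : (0 : ℝ) ∈ Icc 0 ρ := ⟨le_rfl, hρ.le⟩
  have hρm : ρ ∈ Icc 0 ρ := ⟨hρ.le, le_rfl⟩
  have hK := isCompact_Icc.image (s := Icc 0 ρ) hq.continuous
  obtain ⟨M, hM0, hM⟩ := hS.F_bounded _ hK
  obtain ⟨a₀, -, ha₀⟩ := (hK.prod (isCompact_closedBall (0 : X) M)).exists_isMinOn
    ⟨(q 0, 0), mem_image_of_mem q h0m, Metric.mem_closedBall_self hM0.le⟩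
    hS.ψ_continuous.continuousOn
  set B := (S.ψ a₀.1 a₀.2)⁻¹ with hB
  have hψ₀ : 0 < S.ψ a₀.1 a₀.2 := hS.ψ_pos _ _
  have hB0 : 0 < B := inv_pos.2 hψ₀
  set r : ℝ → ℝ := (Ioo 0 ρ).indicator fun s => S.rate (q s, deriv q s) with hr
  have hrS : ∀ s ∈ Ioo 0 ρ, ((q s, deriv q s), r s) ∈ S.rateSet := by
    intro s hs
    have : deriv q s ∈ S.costVel (q s) := by
      -- Where `q` is not differentiable, `deriv q s` is `0`, which also belongs to `costVel`.
      by_cases hds : DifferentiableAt ℝ q s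
      · exact hd s hs _ hds.hasDerivAt
      · rw [deriv_zero_of_not_differentiableAt hds]
        exact hS.zero_mem_costVel _
    obtain ⟨r', hr'⟩ := hS.exists_mem_rateSet this
    rw [hr, indicator_of_mem hs]
    exact hS.rate_mem hr'
  have hr0 : ∀ s, 0 ≤ r s := fun s => indicator_nonneg (fun s _ => S.rate_nonneg _) s
  have hrB : ∀ s, ‖r s‖ ≤ B := by
    intro s
    rw [Real.norm_of_nonneg (hr0 s)]
    by_cases hs : s ∈ Ioo 0 ρ
    · obtain ⟨-, v, hv, -, hle⟩ := hrS s hs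
      have hqs := mem_image_of_mem q (Ioo_subset_Icc_self hs)
      have h1 : S.ψ a₀.1 a₀.2 ≤ S.ψ (q s) v :=
        ha₀ (a := (q s, v)) ⟨hqs, mem_closedBall_zero_iff.2 (hM _ hqs v hv)⟩
      rw [hB, ← one_div, le_div_iff₀ hψ₀]
      exact (mul_le_mul_of_nonneg_left h1 (hr0 s)).trans hle
    · rw [hr, indicator_of_notMem hs]
      exact hB0.le
  have hrm : Measurable r := (hS.measurable_rate.comp
    (hq.continuous.measurable.prodMk (measurable_deriv q))).indicator measurableSet_Ioo
  have hri : ∀ a b, IntervalIntegrable r volume a b :=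
    intervalIntegrable_of_norm_le hrm.stronglyMeasurable hrB
  -- The time spent up to cost parameter `s`; it is flat where the curve waits.
  set τ : ℝ → ℝ := fun s => ∫ u in (0 : ℝ)..s, r u with hτ
  have hτL : LipschitzWith ⟨B, hB0.le⟩ τ := by
    have := lipschitzWith_integral_of_norm_le (M := ⟨B, hB0.le⟩) hrm.stronglyMeasurable hrB 0
    simpa using this
  have hτsub : ∀ a b, ∫ u in a..b, r u = τ b - τ a := fun a b =>
    (intervalIntegral.integral_interval_sub_left (hri 0 b) (hri 0 a)).symm
  have hτm : Monotone τ := fun a b hab => by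
    have := intervalIntegral.integral_nonneg (μ := volume) hab fun u _ => hr0 u
    rw [hτsub] at this
    linarith
  have hτ0 : τ 0 = 0 := by simp [hτ]
  have hT : 0 ≤ τ ρ := hτ0 ▸ hτm hρ.le
  have hqd : ∀ᵐ s, DifferentiableAt ℝ q s := hq.ae_differentiableAt_real
  have hqτ : ∀ a ∈ Icc 0 ρ, ∀ b ∈ Icc 0 ρ, a ≤ b → ‖q b - q a‖ ≤ M * (τ b - τ a) := by
    intro a ha b hb hab
    rw [← hτsub]
    refine AbsolutelyContinuousOnInterval.norm_sub_le hab
      (hq.lipschitzOnWith).absolutelyContinuousOnInterval hM0.le (hri a b) hr0 ?_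
    rw [← restrict_Ioo_eq_restrict_Icc]
    filter_upwards [ae_restrict_of_ae hqd, ae_restrict_mem measurableSet_Ioo] with s hs hs'
    have hsI : s ∈ Ioo 0 ρ := ⟨ha.1.trans_lt hs'.1, hs'.2.trans_le hb.2⟩
    obtain ⟨-, v, hv, e, -⟩ := hrS s hsI
    exact ⟨v, hM _ (mem_image_of_mem q (Ioo_subset_Icc_self hsI)) v hv, e ▸ hs.hasDerivAt⟩
  have himg : Icc 0 (τ ρ) = τ '' Icc 0 ρ := by
    apply subset_antisymm
    · have := intermediate_value_Icc hρ.le hτL.continuous.continuousOn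
      rwa [hτ0] at this
    · rintro _ ⟨s, hs, rfl⟩
      exact ⟨hτ0 ▸ hτm hs.1, hτm hs.2⟩
  -- This right inverse may jump at flat parts of `τ`, but there `q` is constant by `hqτ`, so `q ∘
  -- g` is Lipschitz.
  set g := Function.invFunOn τ (Icc 0 ρ) with hg
  have hgm : ∀ t ∈ Icc 0 (τ ρ), g t ∈ Icc 0 ρ := fun t ht =>
    Function.invFunOn_mem (by rwa [himg] at ht)
  have hgτ : ∀ t ∈ Icc 0 (τ ρ), τ (g t) = t := fun t ht =>
    Function.invFunOn_eq (by rwa [himg] at ht)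
  have hτI : ∀ s ∈ Icc 0 ρ, τ s ∈ Icc 0 (τ ρ) := fun s hs => himg ▸ mem_image_of_mem τ hs
  have hqg : ∀ s ∈ Icc 0 ρ, q (g (τ s)) = q s := by
    intro s hs
    have h1 := hgm _ (hτI s hs)
    have h2 := hgτ _ (hτI s hs)
    rcases le_total (g (τ s)) s with h | h
    · have := hqτ _ h1 s hs h
      rw [h2, sub_self, mul_zero, norm_le_zero_iff, sub_eq_zero] at this
      exact this.symm
    · have := hqτ s hs _ h1 h
      rw [h2, sub_self, mul_zero, norm_le_zero_iff, sub_eq_zero] at this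
      exact this
  have hpL : LipschitzOnWith ⟨M, hM0.le⟩ (fun t => q (g t)) (Icc 0 (τ ρ)) := by
    refine lipschitzOnWith_of_norm_sub_le fun a ha b hb hab => ?_
    rcases hab.eq_or_lt with rfl | hab
    · simp
    have hlt : g a < g b := by
      by_contra! hle
      have := hτm hle
      rw [hgτ a ha, hgτ b hb] at this
      linarith
    have := hqτ _ (hgm a ha) _ (hgm b hb) hlt.le
    rwa [hgτ a ha, hgτ b hb] at this
  -- On these good parameters the rate is positive, so `g` is a true inverse of `τ` there and the
  -- chain rule applies.
  set A : Set ℝ := (Ioo 0 ρ ∩ {s | DifferentiableAt ℝ q s}) ∩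
    ({s | DifferentiableAt ℝ τ s} ∩ {s | deriv τ s = r s}) ∩ {s | 0 < r s} with hA
  have hAm : MeasurableSet A :=
    ((measurableSet_Ioo.inter (measurableSet_of_differentiableAt ℝ q)).inter
      ((measurableSet_of_differentiableAt ℝ τ).inter
        (measurableSet_eq_fun (measurable_deriv τ) hrm))).inter
      (measurableSet_lt measurable_const hrm)
  have hAI : ∀ s ∈ A, s ∈ Ioo 0 ρ := fun s hs => hs.1.1.1
  have hAτ : ∀ s ∈ A, HasDerivAt τ (r s) s := fun s hs => by
    have h1 : DifferentiableAt ℝ τ s := hs.1.2.1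
    have h2 : deriv τ s = r s := hs.1.2.2
    exact h2 ▸ h1.hasDerivAt
  have hstrict : ∀ s ∈ A, ∀ a b, a < b → s ∈ Icc a b → τ a < τ b := by
    intro s hs a b hab hsab
    refine (hτm hab.le).lt_of_ne fun h => ?_
    exact hs.2.ne' ((hτm.monotoneOn _).deriv_eq_zero_of_eq hab h hsab (hAτ s hs))
  have hgA : ∀ s ∈ A, g (τ s) = s := by
    intro s hs
    have h2 := hgτ _ (hτI s (Ioo_subset_Icc_self (hAI s hs)))
    rcases lt_trichotomy (g (τ s)) s with h | h | h
    · exact absurd h2 (hstrict s hs _ _ h ⟨h.le, le_rfl⟩).ne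
    · exact h
    · exact absurd h2 (hstrict s hs _ _ h ⟨le_rfl, h.le⟩).ne'
  have hpd : ∀ s ∈ A, HasDerivAt (fun t => q (g t)) ((r s)⁻¹ • deriv q s) (τ s) := by
    intro s hs
    have hsI := hAI s hs
    have hτs : Ioo 0 (τ ρ) ∈ nhds (τ s) := by
      refine isOpen_Ioo.mem_nhds ⟨?_, hstrict s hs _ _ hsI.2 ⟨le_rfl, hsI.2.le⟩⟩
      have := hstrict s hs _ _ hsI.1 ⟨hsI.1.le, le_rfl⟩
      rwa [hτ0] at this
    have hcont : ContinuousAt g (τ s) := by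
      rw [ContinuousAt, hgA s hs, tendsto_order]
      refine ⟨fun a ha => ?_, fun b hb => ?_⟩
      · filter_upwards [hτs, lt_mem_nhds (hstrict s hs _ _ ha ⟨ha.le, le_rfl⟩)] with t ht hat
        by_contra! hle
        have := hτm hle
        rw [hgτ t (Ioo_subset_Icc_self ht)] at this
        linarith
      · filter_upwards [hτs, gt_mem_nhds (hstrict s hs _ _ hb ⟨le_rfl, hb.le⟩)] with t ht hat
        by_contra! hle
        have := hτm hle
        rw [hgτ t (Ioo_subset_Icc_self ht)] at this
        linarith
    have hgd : HasDerivAt g (r s)⁻¹ (τ s) := by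
      refine HasDerivAt.of_local_left_inverse (f := τ) hcont ?_ (ne_of_gt hs.2) ?_
      · rw [hgA s hs]
        exact hAτ s hs
      · filter_upwards [hτs] with t ht using hgτ t (Ioo_subset_Icc_self ht)
    have hqs : DifferentiableAt ℝ q s := hs.1.1.2
    have hqs' : HasDerivAt q (deriv q s) (g (τ s)) := by
      rw [hgA s hs]
      exact hqs.hasDerivAt
    exact hqs'.scomp (τ s) hgd
  have hvel : ∀ s ∈ A, (r s)⁻¹ • deriv q s ∈ S.F (q s) ∧
      r s * S.ψ (q s) ((r s)⁻¹ • deriv q s) ≤ 1 := by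
    intro s hs
    have hpos : 0 < r s := hs.2
    obtain ⟨-, v, hv, e, hle⟩ := hrS s (hAI s hs)
    simp only at hv e hle
    rw [e, inv_smul_smul₀ hpos.ne']
    exact ⟨hv, hle⟩
  have hAT : τ '' A ⊆ Icc 0 (τ ρ) := by
    rintro _ ⟨s, hs, rfl⟩
    exact hτI s (Ioo_subset_Icc_self (hAI s hs))
  -- The missing times are images under `τ` either of a null set or of critical points of `τ`; both
  -- images are null.
  have hnull : volume (Icc 0 (τ ρ) \ τ '' A) = 0 := by
    set N : Set ℝ := {s | ¬(s ∈ Icc 0 ρ → s ∈ Ioo 0 ρ ∧ DifferentiableAt ℝ q s ∧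
      HasDerivAt τ (r s) s)} with hN
    have hN0 : volume N = 0 := by
      have h1 := (hri 0 ρ).ae_hasDerivAt_integral
      rw [uIcc_of_le hρ.le] at h1
      have h2 : ∀ᵐ s, s ≠ (0 : ℝ) ∧ s ≠ ρ := by
        rw [Filter.eventually_and]
        exact ⟨Measure.ae_ne volume 0, Measure.ae_ne volume ρ⟩
      have h3 : ∀ᵐ s, s ∈ Icc 0 ρ → s ∈ Ioo 0 ρ ∧ DifferentiableAt ℝ q s ∧
          HasDerivAt τ (r s) s := by
        filter_upwards [h1, h2, hqd] with s hs1 hs2 hs3 hs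
        exact ⟨⟨hs.1.lt_of_ne' hs2.1, hs.2.lt_of_ne hs2.2⟩, hs3, hs1 hs 0 h0m⟩
      exact h3
    refine measure_mono_null ?_ (measure_union_null (hτL.volume_image_eq_zero hN0)
      (volume_image_eq_zero_of_hasDerivAt_zero (f := τ) (s := {s | HasDerivAt τ 0 s})
        fun t ht => ht))
    rintro t ⟨ht, htA⟩
    rw [himg] at ht
    obtain ⟨s, hs, rfl⟩ := ht
    by_cases hsN : s ∈ N
    · exact Or.inl (mem_image_of_mem τ hsN)
    · obtain ⟨h1, h2, h3⟩ := not_not.1 hsN hs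
      refine Or.inr (mem_image_of_mem τ ?_)
      rcases (hr0 s).eq_or_lt with h | h
      · change HasDerivAt τ 0 s
        rwa [← h] at h3
      · have hsA : s ∈ A := ⟨⟨⟨h1, h2⟩, h3.differentiableAt, h3.deriv⟩, h⟩
        exact absurd (mem_image_of_mem τ hsA) htA
  have haeA : (τ '' A : Set ℝ) =ᵐ[volume] Icc 0 (τ ρ) :=
    Filter.EventuallyLE.antisymm hAT.eventuallyLE (ae_le_set.2 hnull)
  have hτAm : MeasurableSet (τ '' A) :=
    hAm.image_of_continuousOn_injOn hτL.continuous.continuousOn fun a ha b hb hab => by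
      rw [← hgA a ha, hab, hgA b hb]
  refine ⟨τ ρ, fun t => q (g t), ?_, ?_⟩
  · have htr := isTraj_of_lipschitzOnWith (S := S) hT hpL ?_
      fun t ht => hmem _ (hgm t ht)
    · have e0 : q (g 0) = q 0 := by
        have := hqg 0 h0m
        rwa [hτ0] at this
      simp only [e0, hqg ρ hρm] at htr
      exact htr
    · rw [← Measure.restrict_congr_set haeA]
      filter_upwards [ae_restrict_mem hτAm] with t ht
      obtain ⟨s, hs, rfl⟩ := ht
      refine ⟨_, ?_, hpd s hs⟩
      rw [hgA s hs]
      exact (hvel s hs).1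
  -- After substituting `t = τ s`, the integrand is `r s` times the running cost, which is at most
  -- one by the definition of `rateSet`.
  · rw [cost, ← setLIntegral_congr haeA, lintegral_image_eq_lintegral_abs_deriv_mul hAm
      (fun s hs => (hAτ s hs).hasDerivWithinAt)
      (fun a ha b hb hab => by rw [← hgA a ha, hab, hgA b hb])]
    calc _ ≤ ∫⁻ _ in A, 1 := by
          refine setLIntegral_mono measurable_const fun s hs => ?_
          rw [(hpd s hs).deriv, hgA s hs, abs_of_nonneg (hr0 s), ← ENNReal.ofReal_mul (hr0 s),
            ← ENNReal.ofReal_one]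
          exact ENNReal.ofReal_le_ofReal (hvel s hs).2
      _ ≤ volume (Ioo 0 ρ) := by
          rw [setLIntegral_one]
          exact measure_mono hAI
      _ = ENNReal.ofReal ρ := by simp

/-- The clearance is lower semicontinuous. -/
theorem Standing.clr_le_of_mem_closure (hS : S.Standing) {ρ : ℝ} (hρ : 0 < ρ) {x : X}
    (hx : x ∈ closure {x | S.clr x < ENNReal.ofReal ρ}) : S.clr x ≤ ENNReal.ofReal ρ := by
  obtain ⟨q, L, h0, hobst, hL, hmem, hd⟩ := hS.exists_curve_of_mem_closure hρ hx
  -- Constant extension beyond the end points makes the curve globally Lipschitz.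
  set q' : ℝ → X := IccExtend hρ.le ((Icc 0 ρ).domRestrict q) with hq'
  have heq : ∀ s ∈ Icc 0 ρ, q' s = q s := fun s hs => IccExtend_of_mem hρ.le _ hs
  have h0m : (0 : ℝ) ∈ Icc 0 ρ := ⟨le_rfl, hρ.le⟩
  have hρm : ρ ∈ Icc 0 ρ := ⟨hρ.le, le_rfl⟩
  obtain ⟨T, p, hp, hc⟩ := hS.exists_traj_of_curve hρ (q := q') (L := L * 1)
    (hL.to_restrict.comp (LipschitzWith.projIcc hρ.le))
    (fun s hs => heq s hs ▸ hmem s hs) fun s hs w hw => by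
      rw [heq s (Ioo_subset_Icc_self hs)]
      refine hd s hs w (hw.congr_of_eventuallyEq ?_)
      filter_upwards [isOpen_Ioo.mem_nhds hs] with u hu
      exact (heq u (Ioo_subset_Icc_self hu)).symm
  rw [heq 0 h0m, heq ρ hρm, h0] at hp
  exact (iInf_le_of_le (q ρ) (iInf_le _ hobst)).trans ((dist_le_cost hp).trans hc)

end ControlSystem

/-! ### The wave envelope along optimal trajectories. -/

namespace ControlSystem

variable {X : Type*} [NormedAddCommGroup X] [InnerProductSpace ℝ X] {m : ℕ}
  {S : ControlSystem X m}

/-- An infimum lies below a supremum over the same set exactly when the set has two distinct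
elements; infinite clearance is excluded since both are then `∞`. -/
theorem mem_envelope_iff {x : X} : x ∈ S.envelope ↔ x ∈ S.free ∧ S.clr x ≠ ∞ ∧
    ∃ ρ₁ > 0, ∃ ρ₂ > ρ₁, x ∈ frontier (S.wave ρ₁) ∧ x ∈ frontier (S.wave ρ₂) := by
  refine and_congr_right fun _ => ?_
  by_cases h : S.clr x = ∞
  · simp [rhoMin, rhoMax, h]
  · rw [rhoMin, rhoMax, if_neg h, if_neg h]
    simp only [iInf_lt_iff, lt_iSup_iff, ne_eq, h, not_false_eq_true, true_and]
    constructor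
    · rintro ⟨ρ₂, ⟨h2, h2'⟩, ρ₁, ⟨h1, h1'⟩, hlt⟩
      exact ⟨ρ₁, h1, ρ₂, (ENNReal.ofReal_lt_ofReal_iff h2).1 hlt, h1', h2'⟩
    · rintro ⟨ρ₁, h1, ρ₂, h2, h1', h2'⟩
      have h3 : 0 < ρ₂ := lt_trans h1 h2
      exact ⟨ρ₂, ⟨h3, h2'⟩, ρ₁, ⟨h1, h1'⟩, (ENNReal.ofReal_lt_ofReal_iff h3).2 h2⟩

/-- A nontrivial trajectory has positive cost. -/
theorem IsTraj.cost_pos [CompleteSpace X] (hS : S.Standing) {x y : X} {T : ℝ} {p : ℝ → X}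
    (h : S.IsTraj x y T p) (hT : 0 < T) : 0 < S.cost T p := by
  by_contra h0
  have hc : S.cost T p = 0 := le_antisymm (not_lt.1 h0) zero_le
  have hm : AEMeasurable (fun t => ENNReal.ofReal (S.ψ (p t) (deriv p t)))
      (volume.restrict (Icc 0 T)) :=
    (h.integrableOn_ψ hS (by simp [hc])).aemeasurable.ennreal_ofReal
  have hae : ∀ᵐ t ∂volume.restrict (Icc 0 T), False := by
    filter_upwards [(lintegral_eq_zero_iff' hm).1 hc] with t ht
    exact absurd (ENNReal.ofReal_eq_zero.1 ht) (not_le.2 (hS.ψ_pos _ _))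
  rw [Filter.eventually_false_iff_eq_bot, ae_eq_bot, Measure.restrict_eq_zero, Real.volume_Icc,
    ENNReal.ofReal_eq_zero] at hae
  linarith

/-- Before its end, an optimal trajectory to a witness stays in the free space. -/
theorem IsOptimalTraj.mem_free [CompleteSpace X] (hS : S.Standing) {x y : X} {T : ℝ} {p : ℝ → X}
    (hp : S.IsOptimalTraj x y T p) (hy : y ∈ S.wit x) (hfin : S.clr x ≠ ∞) {t : ℝ}
    (ht : t ∈ Ico 0 T) : p t ∈ S.free := by
  by_contra hn
  have hobst : p t ∈ S.obst := not_not.1 hn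
  have htI := Ico_subset_Icc_self ht
  -- Meeting the obstacle at time `t` would save the positive cost of the remaining piece.
  have h1 : S.clr x ≤ S.cost t p :=
    (iInf_le_of_le (p t) (iInf_le _ hobst)).trans (dist_le_cost (hp.1.take htI))
  have h2 : S.cost T p = S.clr x := hp.2.trans hy.2
  rw [cost_eq_add S p htI] at h2
  have h3 := (hp.1.drop hS htI).cost_pos hS (sub_pos.2 ht.2)
  have h4 : S.cost t p ≠ ∞ := ne_top_of_le_ne_top hfin (h2 ▸ le_self_add)
  exact absurd (h2.trans_le h1) (not_le.2 (ENNReal.lt_add_right h4 h3.ne'))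

/-- If the clearance is less than `ρ` near the end of a trajectory in the free space, then it is
less than `ρ'` near its start, for all `ρ'` greater than `ρ` plus the cost. -/
theorem IsTraj.mem_interior_wave [FiniteDimensional ℝ X] (hS : S.Standing) {x z : X} {T : ℝ}
    {p : ℝ → X} (h : S.IsTraj x z T p) (hfree : ∀ t ∈ Icc 0 T, p t ∈ S.free) {ρ ρ' : ℝ}
    (hρ : 0 ≤ ρ) (hz : z ∈ interior (S.wave ρ))
    (hlt : S.cost T p + ENNReal.ofReal ρ < ENNReal.ofReal ρ') : x ∈ interior (S.wave ρ') := by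
  have hfin : S.cost T p ≠ ∞ := (le_self_add.trans_lt hlt).ne_top
  have hρ' : 0 < ρ' := ENNReal.ofReal_pos.1 (zero_le.trans_lt hlt)
  have hgap : (S.cost T p).toReal + ρ < ρ' := by
    rw [← ENNReal.ofReal_toReal hfin, ← ENNReal.ofReal_add ENNReal.toReal_nonneg hρ] at hlt
    exact (ENNReal.ofReal_lt_ofReal_iff hρ').1 hlt
  obtain ⟨δ, hδ, hball⟩ := Metric.isOpen_iff.1 isOpen_interior z hz
  -- The first bound makes the followers end in the wave of radius `ρ`; the second keeps their
  -- excess cost within the available gap.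
  have hε : 0 < min δ (ρ' - ((S.cost T p).toReal + ρ)) := lt_min hδ (by linarith)
  have hx : x ∈ S.free := h.start ▸ hfree 0 ⟨le_rfl, h.nonneg⟩
  rw [mem_interior_iff_mem_nhds]
  filter_upwards [h.eventually_exists_near hS hfree hε,
    hS.obst_closed.isOpen_compl.mem_nhds hx] with x' ⟨z', q, hq, hzz, hcost⟩ hx'
  refine ⟨hx', ?_⟩
  have hz' : z' ∈ S.wave ρ := interior_subset (hball (by
    rw [Metric.mem_ball, dist_eq_norm]
    exact hzz.trans_le (min_le_left _ _)))
  calc S.clr x' ≤ S.cost T q + S.clr z' := clr_le_cost_add hS hq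
    _ < S.cost T q + ENNReal.ofReal ρ :=
        ENNReal.add_lt_add_left (ne_top_of_le_ne_top (by finiteness) hcost) hz'.2
    _ ≤ S.cost T p + ENNReal.ofReal (ρ' - ((S.cost T p).toReal + ρ)) + ENNReal.ofReal ρ := by
        gcongr
        exact hcost.trans (by gcongr; exact min_le_right _ _)
    _ = ENNReal.ofReal ρ' := by
        nth_rewrite 1 [← ENNReal.ofReal_toReal hfin]
        have h0 : 0 ≤ (S.cost T p).toReal := ENNReal.toReal_nonneg
        rw [← ENNReal.ofReal_add h0 (by linarith), ← ENNReal.ofReal_add (by linarith) hρ]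
        congr 1
        ring

end ControlSystem

theorem mainTheorem3 {X : Type*} [NormedAddCommGroup X] [InnerProductSpace ℝ X]
    [FiniteDimensional ℝ X] {m : ℕ} (S : ControlSystem X m) (hS : S.Standing)
    (x : X) (hx : x ∈ S.envelope) (y : X) (hy : y ∈ S.wit x)
    (T : ℝ) (p : ℝ → X) (hp : S.IsOptimalTraj x y T p) :
    ∀ t ∈ Set.Ico 0 T, p t ∈ S.envelope := by
  intro t ht
  have : CompleteSpace X := FiniteDimensional.complete ℝ X
  obtain ⟨-, hfin, ρ₁, hρ₁, ρ₂, hρ, h1, h2⟩ := ControlSystem.mem_envelope_iff.1 hx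
  have htI := Ico_subset_Icc_self ht
  have hfree : ∀ s ∈ Icc 0 t, p s ∈ S.free := fun s hs =>
    hp.mem_free hS hy hfin ⟨hs.1, hs.2.trans_lt ht.2⟩
  have hz := hfree t ⟨ht.1, le_rfl⟩
  have hclr : S.clr x ≤ ENNReal.ofReal ρ₁ :=
    hS.clr_le_of_mem_closure hρ₁ (closure_mono (fun _ h => h.2) h1.1)
  -- The rest of the optimal trajectory bounds the clearance of `p t`.
  have hsum : S.cost t p + S.clr (p t) ≤ ENNReal.ofReal ρ₁ := by
    refine le_trans ?_ hclr
    rw [← hy.2, ← hp.2, ControlSystem.cost_eq_add S p htI]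
    gcongr
    exact (iInf_le_of_le y (iInf_le _ (hS.obst_closed.frontier_subset hy.1))).trans
      (ControlSystem.dist_le_cost (hp.1.drop hS htI))
  have hfin' : S.clr (p t) ≠ ∞ := ne_top_of_le_ne_top ENNReal.ofReal_ne_top
    (le_add_self.trans hsum)
  have hcfin : S.cost t p ≠ ∞ := ne_top_of_le_ne_top ENNReal.ofReal_ne_top
    (le_self_add.trans hsum)
  have key : ∀ ρ, (S.clr (p t)).toReal < ρ → ρ < (S.clr (p t)).toReal + (ρ₂ - ρ₁) →
      p t ∈ frontier (S.wave ρ) := by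
    intro ρ hl hr
    have hρ0 : 0 < ρ := ENNReal.toReal_nonneg.trans_lt hl
    refine ⟨subset_closure ⟨hz, (ENNReal.lt_ofReal_iff_toReal_lt hfin').2 hl⟩, fun hint => ?_⟩
    refine h2.2 ((hp.1.take htI).mem_interior_wave hS hfree hρ0.le hint ?_)
    have hsum' : (S.cost t p).toReal + (S.clr (p t)).toReal ≤ ρ₁ := by
      rw [← ENNReal.toReal_add hcfin hfin']
      exact ENNReal.toReal_le_of_le_ofReal hρ₁.le hsum
    rw [← ENNReal.ofReal_toReal hcfin, ← ENNReal.ofReal_add ENNReal.toReal_nonneg hρ0.le]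
    exact (ENNReal.ofReal_lt_ofReal_iff (hρ₁.trans hρ)).2 (by linarith)
  have hgap : 0 < ρ₂ - ρ₁ := sub_pos.2 hρ
  have ha : 0 ≤ (S.clr (p t)).toReal := ENNReal.toReal_nonneg
  -- Any two distinct radii in the window given by `key` would do.
  exact ControlSystem.mem_envelope_iff.2 ⟨hz, hfin', (S.clr (p t)).toReal + (ρ₂ - ρ₁) / 3,
    by positivity, (S.clr (p t)).toReal + (ρ₂ - ρ₁) / 2, by linarith,
    key _ (by linarith) (by linarith), key _ (by linarith) (by linarith)⟩
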